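/- Let $B(x,y)=x_1y_1+x_2y_2-x_3y_3$ on $\mathbb R^2_1=\mathbb R^3$, let $\mathbb H^2=\{B(x,x)=-1,\ x_3>0\}$, oriented so that a tangent vector $b$ at $x$ points to the left of a tangent vector $a$ at $x$ if $\det(a,b,x)>0$, and let $G\subset \mathrm{SO}^o(2,1)\cong\mathrm{PSL}(2,\mathbb R)$ be a finitely generated discrete group all of whose non-trivial elements are hyperbolic, with quotient surface $S=\mathbb H^2/G$, $\pi_1(S)=G$ (for $S$ with holes, this is the group $G_{g,b}$ of a hyperbolic surface $S_{g,b}$). For a hyperbolic $g$ let $X_g^-,X_g^+$ be its future-pointing null eigenvectors of Euclidean norm $1$ for the smallest and the largest eigenvalue, and $X_g^0$ the fixed vector with $B(X_g^0,X_g^0)=1$ and $\det(X_g^0,X_g^-,X_g^+)>0$; let $\ell(g)$ be the hyperbolic translation length of $g$. Let $h\in G$ represent a simple closed geodesic that separates $S$ into two pieces $S_1,S_2$ which meet only along $h$, where $S_2$ lies to the left of the oriented geodesic $h$. Let $\Sigma_1,\Sigma_2\subset G$ be the fundamental groups of $S_1,S_2$, based at a point of $h$. Then there is a unique cocycle $\mathbf{AT}_h:G\to\mathbb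 R^2_1$ (that is, $\mathbf{AT}_h(gk)=g\,\mathbf{AT}_h(k)+\mathbf{AT}_h(g)$) with $\mathbf{AT}_h(g)=0$ for $g\in\Sigma_1$ and $\mathbf{AT}_h(g)=X_h^0-gX_h^0$ for $g\in\Sigma_2$. Identify $\mathbb R^2_1$ with $\mathfrak{sl}_2(\mathbb R)$ by $x\mapsto\begin{pmatrix}x_1&x_2-x_3\\x_2+x_3&-x_1\end{pmatrix}$, an isometry from $B$ to $\tfrac12\operatorname{tr}(XY)$, and let $\rho_t:G\to\mathrm{SO}^o(2,1)$ $(t\in\mathbb R)$ be any family of homomorphisms such that $\rho_0$ is the inclusion, $t\mapsto\rho_t(g)$ is differentiable at $0$ for each $g\in G$, and the cocycle $g\mapsto\left.\frac{d}{dt}\right|_{t=0}\rho_t(g)\,g^{-1}\in\mathfrak{sl}_2(\mathbb R)$ corresponds to $\mathbf{AT}_h$ up to a coboundary $g\mapsto z-gz$. Let $\sigma\in G$, $\sigma\neq1$, be any closed geodesic and $\ell_\sigma(t)=\ell(\rho_t(\sigma))$. Then $\sigma$ and $h$ have only finitely many transverse intersections, $\ell_\sigma$ is differentiable at $0$, and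 $$\left.\frac{d\ell_\sigma}{dt}(t)\right|_{t=0}=2\sum_{p\in h\cap\sigma}\cos(\theta_h^\sigma)_p ,$$ where the sum runs over the transverse intersections of the loops $h$ and $\sigma$, each counted as often as the loop $\sigma$ (of length $\ell(\sigma)$) crosses $h$ there, and $(\theta_h^\sigma)_p\in(0,\pi)$ is the angle at $p$ between the direction of $h$ and the half of $\sigma$ on the left of $h$. -/

import Mathlib

open Real Set Filter Topology Matrix

noncomputable section

/-! ### Lorentzian spacetime, its isometries, and the hyperbolic plane -/

/-- The vector space underlying the `(2+1)`-dimensional Lorentzian spacetime. -/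
abbrev LVec : Type := Fin 3 → ℝ

/-- The Lorentzian inner product `x₁y₁ + x₂y₂ - x₃y₃`. -/
def lorB (x y : LVec) : ℝ := x 0 * y 0 + x 1 * y 1 - x 2 * y 2

/-- The determinant of three vectors; it fixes the orientation. -/
def det3 (x y z : LVec) : ℝ := (Matrix.of ![x, y, z]).det

/-- The hyperbolic plane: the future sheet of the unit hyperboloid. -/
def hypPlane : Set LVec := {x | lorB x x = -1 ∧ 0 < x 2}

/-- The linear action of an invertible matrix on vectors. -/
def lact (g : GL (Fin 3) ℝ) (x : LVec) : LVec := (g : Matrix (Fin 3) (Fin 3) ℝ) *ᵥ x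

theorem lact_one (x : LVec) : lact 1 x = x := by simp [lact]

theorem lact_mul (g k : GL (Fin 3) ℝ) (x : LVec) : lact (g * k) x = lact g (lact k x) := by
  simp [lact, Matrix.mulVec_mulVec]

theorem lact_inv (g : GL (Fin 3) ℝ) (x : LVec) : lact g (lact g⁻¹ x) = x := by
  rw [← lact_mul, mul_inv_cancel, lact_one]

/-- The group `SO°(2,1)`: the linear isometries of the Lorentzian inner product with
determinant one that preserve the future sheet of the hyperboloid. -/
def lorSO : Subgroup (GL (Fin 3) ℝ) where
  carrier := {g | (∀ x y, lorB (lact g x) (lact g y) = lorB x y) ∧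
    (g : Matrix (Fin 3) (Fin 3) ℝ).det = 1 ∧ ∀ x, lact g x ∈ hypPlane ↔ x ∈ hypPlane}
  one_mem' := by
    refine ⟨fun x y => by simp only [lact_one], by simp, fun x => by simp only [lact_one]⟩
  mul_mem' := by
    rintro a b ⟨ha, ha', ha''⟩ ⟨hb, hb', hb''⟩
    refine ⟨fun x y => by rw [lact_mul, lact_mul, ha, hb], ?_, fun x => ?_⟩
    · rw [Units.val_mul, Matrix.det_mul, ha', hb', one_mul]
    · rw [lact_mul, ha'', hb'']
  inv_mem' := by
    rintro a ⟨ha, ha', ha''⟩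
    refine ⟨fun x y => by rw [← ha, lact_inv, lact_inv], ?_, fun x => ?_⟩
    · have h : ((a : Matrix (Fin 3) (Fin 3) ℝ) * ((a⁻¹ : GL (Fin 3) ℝ) :
          Matrix (Fin 3) (Fin 3) ℝ)).det = 1 := by
        rw [← Units.val_mul, mul_inv_cancel, Units.val_one, Matrix.det_one]
      rwa [Matrix.det_mul, ha', one_mul] at h
    · rw [← ha'', lact_inv]

/-- An element of `SO°(2,1)` is hyperbolic if it has three distinct real eigenvalues. -/
def IsHypElt (g : GL (Fin 3) ℝ) : Prop :=
  ∃ a b c : ℝ, a ≠ b ∧ b ≠ c ∧ a ≠ c ∧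
    Module.End.HasEigenvalue (Matrix.toLin' (g : Matrix (Fin 3) (Fin 3) ℝ)) a ∧
    Module.End.HasEigenvalue (Matrix.toLin' (g : Matrix (Fin 3) (Fin 3) ℝ)) b ∧
    Module.End.HasEigenvalue (Matrix.toLin' (g : Matrix (Fin 3) (Fin 3) ℝ)) c

/-- `X0, Xm, Xp` is the null frame of `g`: the future-pointing null eigenvectors `Xm`, `Xp` of
Euclidean norm one for the smallest and the largest eigenvalue, and the unit spacelike vector `X0`
fixed by `g`, oriented by `det (X0, Xm, Xp) > 0`. -/
structure IsNullFrame (g : GL (Fin 3) ℝ) (X0 Xm Xp : LVec) : Prop where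
  eigen : ∃ a c : ℝ, a < 1 ∧ 1 < c ∧ lact g Xm = a • Xm ∧ lact g Xp = c • Xp
  fixed : lact g X0 = X0
  null_minus : lorB Xm Xm = 0
  null_plus : lorB Xp Xp = 0
  future_minus : 0 < Xm 2
  future_plus : 0 < Xp 2
  norm_minus : Xm 0 ^ 2 + Xm 1 ^ 2 + Xm 2 ^ 2 = 1
  norm_plus : Xp 0 ^ 2 + Xp 1 ^ 2 + Xp 2 ^ 2 = 1
  unit : lorB X0 X0 = 1
  orient : 0 < det3 X0 Xm Xp

/-- The hyperbolic distance on the hyperboloid, `cosh d(x,y) = -B(x,y)`. -/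
def hypDist (x y : LVec) : ℝ := Real.arcosh (-lorB x y)

/-- The hyperbolic translation length of `g`: the infimum of its displacement. -/
def transLen (g : GL (Fin 3) ℝ) : ℝ := ⨅ x : hypPlane, hypDist (x : LVec) (lact g x)

/-! ### Fuchsian groups, closed geodesics, and angles -/

/-- `G` is a finitely generated discrete subgroup of `SO°(2,1)` all of whose non-trivial elements
are hyperbolic. The hyperbolic surface is the quotient of `hypPlane` by `G`, and `G` is its
fundamental group. -/
structure IsSurfaceGroup (G : Subgroup (GL (Fin 3) ℝ)) : Prop where
  le_SO : G ≤ lorSO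
  fg : G.FG
  discrete : DiscreteTopology G
  hyperbolic : ∀ g ∈ G, g ≠ 1 → IsHypElt g

/-- The unit-speed geodesic with initial point `p` and initial unit tangent vector `v`. -/
def geod (p v : LVec) (s : ℝ) : LVec := Real.cosh s • p + Real.sinh s • v

/-- The velocity of that geodesic. -/
def geodVel (p v : LVec) (s : ℝ) : LVec := Real.sinh s • p + Real.cosh s • v

/-- `geod p v` is a unit-speed parametrization of the axis of `g`, in the direction in which `g`
translates. On the quotient surface it is the closed geodesic of `g`, with parameter in
`ℝ / (transLen g) ℤ`. -/
structure IsAxis (g : GL (Fin 3) ℝ) (p v : LVec) : Prop where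
  base_mem : p ∈ hypPlane
  tangent : lorB p v = 0
  unit : lorB v v = 1
  translate : ∀ s, lact g (geod p v s) = geod p v (s + transLen g)

/-- The closed geodesic of `h` on the quotient surface is simple: two parameters give the same
point of the surface only if they differ by a multiple of the length. -/
def IsSimpleLoop (G : Subgroup (GL (Fin 3) ℝ)) (h : GL (Fin 3) ℝ) (p v : LVec) : Prop :=
  ∀ g ∈ G, ∀ s t : ℝ, lact g (geod p v s) = geod p v t → ∃ k : ℤ, t = s + k * transLen h

/-- The full preimage in the hyperbolic plane of the projection of `geod p v` to the surface. -/
def fullLift (G : Subgroup (GL (Fin 3) ℝ)) (p v : LVec) : Set LVec :=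
  {x | ∃ g ∈ G, ∃ s : ℝ, x = lact g (geod p v s)}

/-- The closed geodesic covered by `geod p v` separates the surface into two pieces, which meet
only along it; `S₁` and `S₂` are the full preimages of the (closed) pieces, and the pieces are
labelled so that `S₁` lies on the right and `S₂` on the left of the geodesic. -/
structure SeparatesInto (G : Subgroup (GL (Fin 3) ℝ)) (p v : LVec) (S₁ S₂ : Set LVec) : Prop where
  closed₁ : IsClosed S₁
  closed₂ : IsClosed S₂
  invariant₁ : ∀ g ∈ G, ∀ x ∈ S₁, lact g x ∈ S₁
  invariant₂ : ∀ g ∈ G, ∀ x ∈ S₂, lact g x ∈ S₂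
  union : S₁ ∪ S₂ = hypPlane
  inter : S₁ ∩ S₂ = fullLift G p v
  right : ∀ s, ∀ᶠ y in 𝓝[{y ∈ hypPlane | det3 (geodVel p v s) y (geod p v s) < 0}] geod p v s,
    y ∈ S₁
  left : ∀ s, ∀ᶠ y in 𝓝[{y ∈ hypPlane | 0 < det3 (geodVel p v s) y (geod p v s)}] geod p v s,
    y ∈ S₂

/-- The fundamental group of the piece with full preimage `S`, based at the projection of
`x ∈ S`, as a set of elements of `G`: a loop in the piece lifts to a path in `S` from `x` to its
translate by the element of `G` that the loop represents. -/
def pieceGroup (G : Subgroup (GL (Fin 3) ℝ)) (S : Set LVec) (x : LVec) : Set (GL (Fin 3) ℝ) :=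
  {g | g ∈ G ∧ JoinedIn S x (lact g x)}

open Classical in
/-- For unit tangent vectors `a`, `b` at the point `x` of the hyperbolic plane: the angle between
`a` and the one of `b`, `-b` that points to the left of `a`. -/
def leftAngle (x a b : LVec) : ℝ :=
  if 0 < det3 a b x then Real.arccos (lorB a b) else Real.arccos (-lorB a b)

/-- The transverse intersections on the surface of the closed geodesics of `h` (axis `geod p v`)
and `σ` (axis `geod q w`): the pairs of a parameter `s` of the second loop and a parameter `t` of
the first one with the same image point on the surface, together with the element of `G` that
carries the one lift of that point to the other. -/
def crossings (G : Subgroup (GL (Fin 3) ℝ)) (h σ : GL (Fin 3) ℝ) (p v q w : LVec) :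
    Set (ℝ × ℝ × GL (Fin 3) ℝ) :=
  {c | c.1 ∈ Ico 0 (transLen σ) ∧ c.2.1 ∈ Ico 0 (transLen h) ∧ c.2.2 ∈ G ∧
    lact c.2.2 (geod p v c.2.1) = geod q w c.1 ∧
    det3 (lact c.2.2 (geodVel p v c.2.1)) (geodVel q w c.1) (geod q w c.1) ≠ 0}

/-- The angle at a crossing from the loop with axis `geod p v` to the loop with axis `geod q w`. -/
def crossAngle (p v q w : LVec) (c : ℝ × ℝ × GL (Fin 3) ℝ) : ℝ :=
  leftAngle (geod q w c.1) (lact c.2.2 (geodVel p v c.2.1)) (geodVel q w c.1)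

/-! ### Cocycles, the affine twist, and deformations -/

/-- The cocycle condition `u(gk) = g u(k) + u(g)`. -/
def IsLCocycle (G : Subgroup (GL (Fin 3) ℝ)) (u : G → LVec) : Prop :=
  ∀ g k : G, u (g * k) = lact (g : GL (Fin 3) ℝ) (u k) + u g

/-- `u` is the affine twist cocycle: it vanishes on the fundamental group of the first piece and
equals `X0 - g X0` on that of the second one, both based at the projection of `x`. -/
structure IsAffineTwist (G : Subgroup (GL (Fin 3) ℝ)) (X0 x : LVec) (S₁ S₂ : Set LVec)
    (u : G → LVec) : Prop where
  cocycle : IsLCocycle G u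
  first : ∀ g : G, (g : GL (Fin 3) ℝ) ∈ pieceGroup G S₁ x → u g = 0
  second : ∀ g : G, (g : GL (Fin 3) ℝ) ∈ pieceGroup G S₂ x →
    u g = X0 - lact (g : GL (Fin 3) ℝ) X0

/-- The identification of the Lorentzian vector space with `sl₂(ℝ)`, as an isometry for the form
`(1/2) tr(XY)`. It induces `PSL(2,ℝ) ≅ SO°(2,1)` through `toSl2 (A · x) = A (toSl2 x) A⁻¹`, and the
vector `X0` of the null frame of a hyperbolic element corresponds to the positive multiple of its
logarithm. -/
def toSl2 (x : LVec) : Matrix (Fin 2) (Fin 2) ℝ := !![x 0, x 1 - x 2; x 1 + x 2, -x 0]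

/-- `ρ` is a deformation of the inclusion of `G` whose tangent vector at `0` corresponds to the
class of `u` in the first cohomology of `G`: up to a coboundary, `u(g)` is the element
`(d/dt ρ_t(g)) g⁻¹` of the Lie algebra, which acts on vectors by the commutator in `sl₂(ℝ)`. -/
structure IsDeformationAlong (G : Subgroup (GL (Fin 3) ℝ)) (u : G → LVec)
    (ρ : ℝ → G →* GL (Fin 3) ℝ) : Prop where
  mem_SO : ∀ t g, ρ t g ∈ lorSO
  initial : ∀ g : G, ρ 0 g = g
  tangent : ∃ z : LVec, ∀ (g : G) (x : LVec),
    HasDerivAt (fun t => toSl2 (lact (ρ t g) x))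
      ⁅toSl2 (u g + (z - lact (g : GL (Fin 3) ℝ) z)), toSl2 (lact (g : GL (Fin 3) ℝ) x)⁆ 0

end

noncomputable section

/-! ### Lorentzian linear algebra -/

/-! The oriented axis of `h` is recorded by its unit normal `lcross p v`, positive on the left
half-plane; `IsNullFrame.eq_lcross` identifies it with `X0`. Because the loop is simple, the
translates of the axis (the lifts) are pairwise disjoint (`IsSimpleAxis.eq_of_mem`), and
discreteness makes them locally finite (`IsSimpleAxis.finite_lifts`).

Existence. Let the value at `g` be the signed sum of the normals of the lifts that separate `p` from
`g p`. Additivity along chains of points and equivariance make this a cocycle. Here `p` lies on a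
lift, and points of a lift are counted as lying on its right. A path in the right-hand piece crosses
nothing, so the sum vanishes on the first group. For the second group both endpoints are pushed off
their lifts to the left: nothing is crossed in between, and the two pushes contribute `X0` and `-g
X0`.

Uniqueness. The two piece groups generate `G`, by a connectedness argument in place of van Kampen:
the points reachable, inside one piece, from a translate of `p` at which a given cocycle vanishes
form a clopen set (`SeparatesInto.cocycle_eq_zero`).

Derivative. Since the trace of a hyperbolic element is `1 + 2 cosh` of its length, differentiating
the trace in a frame adapted to the axis of `σ` gives `2 B(u(σ), N)`, with `N` the normal of that
axis (`hasDerivAt_transLen`). As `σ` fixes `N`, coboundaries do not contribute. The base point may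
therefore be moved from `p` to a point `q` on the axis of `σ`, where the sum runs over the lifts
crossing one period. Each term is plus or minus the product `B` of the unit tangents at the
crossing, the sign being that of the crossing, and this is the cosine of the left angle
(`IsSimpleAxis.cos_crossAngle`). -/

theorem lorB_comm (x y : LVec) : lorB x y = lorB y x := by simp only [lorB]; ring

theorem lorB_add_left (x y z : LVec) : lorB (x + y) z = lorB x z + lorB y z := by
  simp only [lorB, Pi.add_apply]; ring

theorem lorB_add_right (x y z : LVec) : lorB x (y + z) = lorB x y + lorB x z := by
  simp only [lorB, Pi.add_apply]; ring

theorem lorB_sub_left (x y z : LVec) : lorB (x - y) z = lorB x z - lorB y z := by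
  simp only [lorB, Pi.sub_apply]; ring

theorem lorB_sub_right (x y z : LVec) : lorB x (y - z) = lorB x y - lorB x z := by
  simp only [lorB, Pi.sub_apply]; ring

theorem lorB_smul_left (a : ℝ) (x y : LVec) : lorB (a • x) y = a * lorB x y := by
  simp only [lorB, Pi.smul_apply, smul_eq_mul]; ring

theorem lorB_smul_right (a : ℝ) (x y : LVec) : lorB x (a • y) = a * lorB x y := by
  simp only [lorB, Pi.smul_apply, smul_eq_mul]; ring

theorem lorB_neg_left (x y : LVec) : lorB (-x) y = -lorB x y := by
  simp only [lorB, Pi.neg_apply]; ring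

theorem lorB_neg_right (x y : LVec) : lorB x (-y) = -lorB x y := by
  simp only [lorB, Pi.neg_apply]; ring

theorem lorB_zero_right (x : LVec) : lorB x 0 = 0 := by simp [lorB]

theorem lorB_zero_left (x : LVec) : lorB 0 x = 0 := by simp [lorB]

theorem continuous_lorB (x : LVec) : Continuous fun y => lorB x y := by
  unfold lorB; fun_prop

theorem lorB_ext {x y : LVec} (h : ∀ z, lorB x z = lorB y z) : x = y := by
  ext i
  have h0 := h ![1, 0, 0]
  have h1 := h ![0, 1, 0]
  have h2 := h ![0, 0, 1]
  simp [lorB] at h0 h1 h2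
  fin_cases i <;> simp_all

/-- Pairing with a fixed vector, as an additive map. -/
def lorBHom (y : LVec) : LVec →+ ℝ where
  toFun x := lorB x y
  map_zero' := lorB_zero_left y
  map_add' a b := lorB_add_left a b y

theorem det3_eq (x y z : LVec) : det3 x y z = x 0 * y 1 * z 2 - x 0 * y 2 * z 1
    - x 1 * y 0 * z 2 + x 1 * y 2 * z 0 + x 2 * y 0 * z 1 - x 2 * y 1 * z 0 := by
  simp [det3, Matrix.det_fin_three]

/-- The Lorentzian cross product. -/
def lcross (x y : LVec) : LVec :=
  ![x 1 * y 2 - x 2 * y 1, x 2 * y 0 - x 0 * y 2, x 1 * y 0 - x 0 * y 1]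

theorem lorB_lcross (x y z : LVec) : lorB (lcross x y) z = det3 z x y := by
  rw [det3_eq]; simp [lorB, lcross]; ring

theorem lorB_lcross_lcross (x y z w : LVec) :
    lorB (lcross x y) (lcross z w) = lorB x w * lorB y z - lorB x z * lorB y w := by
  simp [lorB, lcross]; ring

theorem lorB_lcross_left (x y : LVec) : lorB (lcross x y) x = 0 := by
  rw [lorB_lcross, det3_eq]; ring

theorem lorB_lcross_right (x y : LVec) : lorB (lcross x y) y = 0 := by
  rw [lorB_lcross, det3_eq]; ring

theorem lact_add (g : GL (Fin 3) ℝ) (x y : LVec) : lact g (x + y) = lact g x + lact g y :=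
  Matrix.mulVec_add _ _ _

theorem lact_sub (g : GL (Fin 3) ℝ) (x y : LVec) : lact g (x - y) = lact g x - lact g y :=
  Matrix.mulVec_sub _ _ _

theorem lact_neg (g : GL (Fin 3) ℝ) (x : LVec) : lact g (-x) = -lact g x :=
  Matrix.mulVec_neg _ _

theorem lact_zero (g : GL (Fin 3) ℝ) : lact g 0 = 0 :=
  Matrix.mulVec_zero _

theorem lact_smul (g : GL (Fin 3) ℝ) (a : ℝ) (x : LVec) : lact g (a • x) = a • lact g x :=
  Matrix.mulVec_smul _ _ _

theorem lact_inv_lact (g : GL (Fin 3) ℝ) (x : LVec) : lact g⁻¹ (lact g x) = x := by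
  rw [← lact_mul, inv_mul_cancel, lact_one]

theorem continuous_lact (g : GL (Fin 3) ℝ) : Continuous (lact g) := by
  unfold lact; fun_prop

/-- The linear action as an additive map. -/
def lactHom (g : GL (Fin 3) ℝ) : LVec →+ LVec where
  toFun := lact g
  map_zero' := lact_zero g
  map_add' := lact_add g

theorem det3_lact (g : GL (Fin 3) ℝ) (x y z : LVec) :
    det3 (lact g x) (lact g y) (lact g z) = (g : Matrix (Fin 3) (Fin 3) ℝ).det * det3 x y z := by
  simp only [det3_eq, lact, Matrix.det_fin_three, Matrix.mulVec, dotProduct, Fin.sum_univ_three]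
  ring

section lorSO

variable {g : GL (Fin 3) ℝ}

theorem lorB_lact (hg : g ∈ lorSO) (x y : LVec) : lorB (lact g x) (lact g y) = lorB x y :=
  hg.1 x y

theorem lact_mem_hypPlane (hg : g ∈ lorSO) {x : LVec} (hx : x ∈ hypPlane) :
    lact g x ∈ hypPlane := (hg.2.2 x).2 hx

theorem lorB_lact_left (hg : g ∈ lorSO) (x y : LVec) :
    lorB (lact g x) y = lorB x (lact g⁻¹ y) := by
  rw [← lorB_lact hg x, lact_inv]

/-- The cross product is dual to `det3` under `lorB`, and a Lorentz isometry of determinant one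
preserves both. -/
theorem lact_lcross (hg : g ∈ lorSO) (x y : LVec) :
    lact g (lcross x y) = lcross (lact g x) (lact g y) := by
  apply lorB_ext
  intro z
  rw [lorB_lact_left hg, lorB_lcross, lorB_lcross, ← lact_inv g z, det3_lact, hg.2.1, one_mul,
    lact_inv]

end lorSO

/-- The factor 2 here is the source of the factor 2 in the derivative formula. -/
theorem toSl2_bracket (a b : LVec) : ⁅toSl2 a, toSl2 b⁆ = toSl2 ((2 : ℝ) • lcross a b) := by
  rw [Ring.lie_def]
  ext i j
  fin_cases i <;> fin_cases j <;>
    simp [toSl2, lcross] <;> ring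

/-! ### The hyperboloid -/

theorem sq_add_one_of_mem_hypPlane {x : LVec} (hx : x ∈ hypPlane) :
    x 0 ^ 2 + x 1 ^ 2 + 1 = x 2 ^ 2 := by
  have := hx.1
  simp only [lorB] at this
  nlinarith

theorem lorB_le_neg_one {x y : LVec} (hx : x ∈ hypPlane) (hy : y ∈ hypPlane) :
    lorB x y ≤ -1 := by
  have h1 := sq_add_one_of_mem_hypPlane hx
  have h2 := sq_add_one_of_mem_hypPlane hy
  have hpos : 0 < x 2 * y 2 := mul_pos hx.2 hy.2
  have key : (x 0 * y 0 + x 1 * y 1 + 1) ^ 2 ≤ (x 2 * y 2) ^ 2 := by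
    have : (x 2 * y 2) ^ 2 = (x 0 ^ 2 + x 1 ^ 2 + 1) * (y 0 ^ 2 + y 1 ^ 2 + 1) := by
      rw [h1, h2]; ring
    rw [this]
    nlinarith [sq_nonneg (x 0 * y 1 - x 1 * y 0), sq_nonneg (x 0 - y 0), sq_nonneg (x 1 - y 1)]
  have := abs_le_of_sq_le_sq' key hpos.le
  simp only [lorB]
  linarith [this.2]

theorem mem_hypPlane_of_lorB_neg {x y : LVec} (hx : lorB x x = -1) (hy : y ∈ hypPlane)
    (hxy : lorB x y < 0) : x ∈ hypPlane := by
  refine ⟨hx, ?_⟩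
  by_contra! h
  have hx' : lorB x x = -1 := hx
  simp only [lorB] at hx'
  have h2 : x 2 ≠ 0 := by
    intro h0
    rw [h0] at hx'
    nlinarith [sq_nonneg (x 0), sq_nonneg (x 1)]
  have h3 : -x ∈ hypPlane := by
    refine ⟨by rw [lorB_neg_left, lorB_neg_right, neg_neg, hx], ?_⟩
    have : x 2 < 0 := lt_of_le_of_ne h h2
    simpa using this
  have := lorB_le_neg_one h3 hy
  rw [lorB_neg_left] at this
  linarith

theorem lorB_self_pos_of_orthogonal {x u : LVec} (hx : x ∈ hypPlane) (hxu : lorB x u = 0)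
    (hu : u ≠ 0) : 0 < lorB u u := by
  have h1 := sq_add_one_of_mem_hypPlane hx
  simp only [lorB] at hxu ⊢
  by_contra! h
  have hcs : (x 2 * u 2) ^ 2 ≤ (x 0 ^ 2 + x 1 ^ 2) * (u 0 ^ 2 + u 1 ^ 2) := by
    have : x 2 * u 2 = x 0 * u 0 + x 1 * u 1 := by linarith
    rw [this]
    nlinarith [sq_nonneg (x 0 * u 1 - x 1 * u 0)]
  have h2 : u 0 ^ 2 + u 1 ^ 2 ≤ u 2 ^ 2 := by nlinarith
  have h3 : u 2 ^ 2 ≤ 0 := by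
    have h4 : (x 0 ^ 2 + x 1 ^ 2) * (u 0 ^ 2 + u 1 ^ 2) ≤ (x 0 ^ 2 + x 1 ^ 2) * u 2 ^ 2 := by
      gcongr
    have h5 : (x 2 * u 2) ^ 2 = (x 0 ^ 2 + x 1 ^ 2 + 1) * u 2 ^ 2 := by rw [h1]; ring
    nlinarith
  apply hu
  have e2 : u 2 = 0 := by nlinarith [sq_nonneg (u 2)]
  have e0 : u 0 = 0 := by nlinarith [sq_nonneg (u 0), sq_nonneg (u 1)]
  have e1 : u 1 = 0 := by nlinarith [sq_nonneg (u 0), sq_nonneg (u 1)]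
  ext i
  fin_cases i <;> assumption

/-- `p, v` is a unit tangent vector of the hyperbolic plane. -/
structure IsUnitTangent (p v : LVec) : Prop where
  base_mem : p ∈ hypPlane
  tangent : lorB p v = 0
  unit : lorB v v = 1

theorem IsAxis.isUnitTangent {g : GL (Fin 3) ℝ} {p v : LVec} (h : IsAxis g p v) :
    IsUnitTangent p v := ⟨h.base_mem, h.tangent, h.unit⟩

namespace IsUnitTangent

variable {p v : LVec} (hpv : IsUnitTangent p v)
include hpv

theorem lorB_base : lorB p p = -1 := hpv.base_mem.1

theorem tangent' : lorB v p = 0 := by rw [lorB_comm, hpv.tangent]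

theorem lorB_normal : lorB (lcross p v) (lcross p v) = 1 := by
  rw [lorB_lcross_lcross, hpv.tangent, hpv.lorB_base, hpv.unit]; ring

/-- `p`, `v`, `lcross p v` is a Lorentz-orthonormal frame. The proof is Cramer's rule, with each
determinant rewritten as a Lorentz product. -/
theorem decomp (z : LVec) :
    z = -lorB z p • p + lorB z v • v + lorB z (lcross p v) • lcross p v := by
  have h1 : det3 (lcross p v) z v = -lorB z p := by
    rw [← lorB_lcross, lorB_lcross_lcross, hpv.tangent', hpv.unit]; ring
  have h2 : det3 (lcross p v) p z = lorB z v := by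
    rw [← lorB_lcross, lorB_lcross_lcross, hpv.tangent, hpv.lorB_base]; ring
  have h3 : det3 (lcross p v) p v = 1 := by
    rw [← lorB_lcross, hpv.lorB_normal]
  have h4 : lorB z (lcross p v) = det3 z p v := by rw [lorB_comm, lorB_lcross]
  have key : det3 (lcross p v) p v • z = det3 (lcross p v) z v • p
      + det3 (lcross p v) p z • v + det3 z p v • lcross p v := by
    simp only [det3_eq]
    ext i
    fin_cases i <;> simp <;> ring
  rwa [h1, h2, h3, one_smul, ← h4] at key

theorem lact {g : GL (Fin 3) ℝ} (hg : g ∈ lorSO) : IsUnitTangent (lact g p) (lact g v) :=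
  ⟨lact_mem_hypPlane hg hpv.base_mem, by rw [lorB_lact hg, hpv.tangent],
    by rw [lorB_lact hg, hpv.unit]⟩

theorem geod (s : ℝ) : IsUnitTangent (geod p v s) (geodVel p v s) := by
  have hb := hpv.lorB_base
  have ht := hpv.tangent
  have ht' := hpv.tangent'
  have hu := hpv.unit
  have hcs := Real.cosh_sq s
  refine ⟨mem_hypPlane_of_lorB_neg ?_ hpv.base_mem ?_, ?_, ?_⟩
  · simp only [_root_.geod, lorB_add_left, lorB_add_right, lorB_smul_left, lorB_smul_right, hb, ht,
      ht', hu]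
    nlinarith
  · simp only [_root_.geod, lorB_add_left, lorB_smul_left, hb, ht']
    linarith [Real.cosh_pos s]
  · simp only [_root_.geod, geodVel, lorB_add_left, lorB_add_right, lorB_smul_left, lorB_smul_right,
      hb, ht, ht', hu]
    ring
  · simp only [geodVel, lorB_add_left, lorB_add_right, lorB_smul_left, lorB_smul_right, hb, ht,
      ht', hu]
    nlinarith

theorem exists_geod_eq {x : LVec} (hx : x ∈ hypPlane) (h0 : lorB (lcross p v) x = 0) :
    ∃ t, x = _root_.geod p v t := by
  have hd := hpv.decomp x
  rw [lorB_comm x (lcross p v), h0, zero_smul, add_zero] at hd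
  have hb := hpv.lorB_base
  have hxx : lorB x x = -1 := hx.1
  have h1 := lorB_le_neg_one hx hpv.base_mem
  have h2 : (-lorB x p) ^ 2 = lorB x v ^ 2 + 1 := by
    rw [hd] at hxx
    simp only [lorB_add_left, lorB_add_right, lorB_smul_left, lorB_smul_right, hb, hpv.tangent,
      hpv.tangent', hpv.unit] at hxx
    linear_combination -hxx
  refine ⟨Real.arsinh (lorB x v), ?_⟩
  rw [_root_.geod, Real.sinh_arsinh, Real.cosh_arsinh]
  have h3 : √(1 + lorB x v ^ 2) = -lorB x p := by
    rw [add_comm, ← h2, Real.sqrt_sq (by linarith)]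
  rw [h3]
  exact hd

end IsUnitTangent

theorem lcross_geod (p v : LVec) (s : ℝ) : lcross (geod p v s) (geodVel p v s) = lcross p v := by
  have hcs := Real.cosh_sq s
  ext i
  fin_cases i <;> simp [lcross, geod, geodVel]
  · linear_combination (p 1 * v 2 - p 2 * v 1) * hcs
  · linear_combination (p 2 * v 0 - p 0 * v 2) * hcs
  · linear_combination (p 1 * v 0 - p 0 * v 1) * hcs

theorem det3_geodVel (p v y : LVec) (s : ℝ) :
    det3 (geodVel p v s) y (geod p v s) = lorB (lcross p v) y := by
  rw [← lcross_geod p v s, lorB_lcross]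
  simp only [det3_eq]; ring

theorem geod_zero (p v : LVec) : geod p v 0 = p := by simp [geod]

theorem geodVel_zero (p v : LVec) : geodVel p v 0 = v := by simp [geodVel]

theorem geod_add (p v : LVec) (s t : ℝ) :
    geod p v (s + t) = geod (geod p v s) (geodVel p v s) t := by
  simp only [geod, geodVel, Real.cosh_add, Real.sinh_add]
  module

theorem geodVel_add (p v : LVec) (s t : ℝ) :
    geodVel p v (s + t) = geodVel (geod p v s) (geodVel p v s) t := by
  simp only [geod, geodVel, Real.cosh_add, Real.sinh_add]
  module

theorem lact_geod (g : GL (Fin 3) ℝ) (p v : LVec) (s : ℝ) :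
    lact g (geod p v s) = geod (lact g p) (lact g v) s := by
  simp only [geod, lact_add, lact_smul]

theorem lact_geodVel (g : GL (Fin 3) ℝ) (p v : LVec) (s : ℝ) :
    lact g (geodVel p v s) = geodVel (lact g p) (lact g v) s := by
  simp only [geodVel, lact_add, lact_smul]

theorem continuous_geod (p v : LVec) : Continuous (geod p v) := by
  unfold geod
  fun_prop

/-- An isometry with a fixed point in the hyperbolic plane is not hyperbolic. -/
theorem not_isHypElt_of_fixed {g : GL (Fin 3) ℝ} (hg : g ∈ lorSO) {x : LVec} (hx : x ∈ hypPlane)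
    (hfix : lact g x = x) : ¬ IsHypElt g := by
  rintro ⟨a, b, c, hab, hbc, hac, ha, hb, hc⟩
  -- An eigenvector orthogonal to the fixed point is spacelike, so its eigenvalue has square one;
  -- any other eigenvector pairs nontrivially with the fixed point, so its eigenvalue is one. Two
  -- values cannot supply three distinct eigenvalues.
  have key : ∀ l : ℝ, Module.End.HasEigenvalue
      (Matrix.toLin' (g : Matrix (Fin 3) (Fin 3) ℝ)) l → l = 1 ∨ l = -1 := by
    intro l hl
    obtain ⟨e, he⟩ := hl.exists_hasEigenvector
    have h1 : lact g e = l • e := by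
      have := he.apply_eq_smul
      rwa [Matrix.toLin'_apply] at this
    have h0 : e ≠ 0 := he.2
    by_cases hxe : lorB x e = 0
    · have hpos := lorB_self_pos_of_orthogonal hx hxe h0
      have h2 := lorB_lact hg e e
      rw [h1, lorB_smul_left, lorB_smul_right] at h2
      have h3 : (l ^ 2 - 1) * lorB e e = 0 := by linarith
      rcases mul_eq_zero.1 h3 with h4 | h4
      · have h5 : (l - 1) * (l + 1) = 0 := by linarith
        rcases mul_eq_zero.1 h5 with h6 | h6
        · left; linarith
        · right; linarith
      · exact absurd h4 hpos.ne'
    · left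
      have h2 := lorB_lact hg x e
      rw [h1, hfix, lorB_smul_right] at h2
      have : (l - 1) * lorB x e = 0 := by linarith
      rcases mul_eq_zero.1 this with h4 | h4
      · linarith
      · exact absurd h4 hxe
  rcases key a ha with rfl | rfl <;> rcases key b hb with rfl | rfl <;>
    rcases key c hc with rfl | rfl <;> simp_all

/-! ### Proper discontinuity -/

theorem lorB_single (i : Fin 3) (y : LVec) :
    lorB (Pi.single i 1) y = ![1, 1, -1] i * y i := by
  fin_cases i <;> simp [lorB]

theorem lact_single (g : GL (Fin 3) ℝ) (i j : Fin 3) :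
    lact g (Pi.single j 1) i = (g : Matrix (Fin 3) (Fin 3) ℝ) i j := by
  simp [lact]

theorem single_two_mem_hypPlane : (Pi.single 2 1 : LVec) ∈ hypPlane := by
  constructor
  · rw [lorB_single]; simp
  · simp

theorem abs_inv_apply {g : GL (Fin 3) ℝ} (hg : g ∈ lorSO) (i j : Fin 3) :
    |((g⁻¹ : GL (Fin 3) ℝ) : Matrix (Fin 3) (Fin 3) ℝ) i j| =
      |(g : Matrix (Fin 3) (Fin 3) ℝ) j i| := by
  have h := lorB_lact_left hg (Pi.single i 1) (Pi.single j 1)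
  rw [lorB_comm, lorB_single, lorB_single, lact_single, lact_single] at h
  have habs := congrArg abs h
  have h1 : ∀ k : Fin 3, |(![1, 1, -1] : Fin 3 → ℝ) k| = 1 := by
    intro k; fin_cases k <;> simp
  rw [abs_mul, abs_mul, h1, h1, one_mul, one_mul] at habs
  exact habs.symm

/-- The last row of `g` is, up to signs, the last column of its inverse, a point of the hyperboloid;
this bounds it by the corner entry. The Lorentz norms of the columns then bound everything else. -/
theorem abs_apply_le {g : GL (Fin 3) ℝ} (hg : g ∈ lorSO) (i j : Fin 3) :
    |(g : Matrix (Fin 3) (Fin 3) ℝ) i j| ≤ |(g : Matrix (Fin 3) (Fin 3) ℝ) 2 2| + 1 := by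
  set A : Matrix (Fin 3) (Fin 3) ℝ := (g : Matrix (Fin 3) (Fin 3) ℝ)
  have hrow : ∀ j, A 2 j ^ 2 ≤ A 2 2 ^ 2 := by
    intro j
    have hm := lact_mem_hypPlane (lorSO.inv_mem hg) single_two_mem_hypPlane
    have hs := sq_add_one_of_mem_hypPlane hm
    rw [lact_single, lact_single, lact_single] at hs
    rw [(sq_eq_sq_iff_abs_eq_abs _ _).2 (abs_inv_apply hg 0 2),
      (sq_eq_sq_iff_abs_eq_abs _ _).2 (abs_inv_apply hg 1 2),
      (sq_eq_sq_iff_abs_eq_abs _ _).2 (abs_inv_apply hg 2 2)] at hs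
    fin_cases j
    · change A 2 0 ^ 2 ≤ A 2 2 ^ 2
      nlinarith [sq_nonneg (A 2 1)]
    · change A 2 1 ^ 2 ≤ A 2 2 ^ 2
      nlinarith [sq_nonneg (A 2 0)]
    · exact le_rfl
  have hcol : A i j ^ 2 ≤ A 2 2 ^ 2 + 1 := by
    have h1 := lorB_lact hg (Pi.single j 1) (Pi.single j 1)
    rw [lorB_single j] at h1
    simp only [lorB, lact_single] at h1
    have h2 : (![1, 1, -1] : Fin 3 → ℝ) j * (Pi.single j 1 : LVec) j ≤ 1 := by
      fin_cases j <;> simp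
    have h3 := hrow j
    change A 0 j * A 0 j + A 1 j * A 1 j - A 2 j * A 2 j = _ at h1
    fin_cases i
    · change A 0 j ^ 2 ≤ _
      nlinarith [sq_nonneg (A 1 j)]
    · change A 1 j ^ 2 ≤ _
      nlinarith [sq_nonneg (A 0 j)]
    · change A 2 j ^ 2 ≤ _
      linarith
  apply abs_le_of_sq_le_sq _ (by positivity)
  have := sq_abs (A 2 2)
  nlinarith [abs_nonneg (A 2 2)]

/-- The topology of the unit group comes from the closed embedding `g ↦ (g, g⁻¹)`, so both matrices
must be bounded. -/
theorem isCompact_bounded_units (M : ℝ) :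
    IsCompact {g : GL (Fin 3) ℝ | (∀ i j, (g : Matrix (Fin 3) (Fin 3) ℝ) i j ∈ Icc (-M) M) ∧
      ∀ i j, ((g⁻¹ : GL (Fin 3) ℝ) : Matrix (Fin 3) (Fin 3) ℝ) i j ∈ Icc (-M) M} := by
  have hK : IsCompact {A : Matrix (Fin 3) (Fin 3) ℝ | ∀ i j, A i j ∈ Icc (-M) M} := by
    have := isCompact_univ_pi (X := fun _ : Fin 3 => Fin 3 → ℝ)
      (s := fun _ => Set.pi univ fun _ => Icc (-M) M)
      fun _ => isCompact_univ_pi fun _ => isCompact_Icc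
    have hset : {A : Matrix (Fin 3) (Fin 3) ℝ | ∀ i j, A i j ∈ Icc (-M) M} =
        Set.pi univ fun _ => Set.pi univ fun _ => Icc (-M) M :=
      Set.ext fun A => ⟨fun h i _ j _ => h i j, fun h i j => h i trivial j trivial⟩
    rw [hset]
    exact this
  have hK' : IsCompact (MulOpposite.unop ⁻¹'
      {A : Matrix (Fin 3) (Fin 3) ℝ | ∀ i j, A i j ∈ Icc (-M) M}) :=
    (MulOpposite.opHomeomorph.symm.isClosedEmbedding.isCompact_preimage hK)
  exact Units.isClosedEmbedding_embedProduct.isCompact_preimage (hK.prod hK')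

/-- The coordinate `x 2` is `cosh` of the distance to the apex, so this is the triangle inequality
combined with `cosh (a + b) ≤ 2 cosh a cosh b`. -/
theorem apply_two_le {y z : LVec} (hy : y ∈ hypPlane) (hz : z ∈ hypPlane) :
    y 2 ≤ 2 * z 2 * -lorB y z := by
  have h1 := sq_add_one_of_mem_hypPlane hy
  have h2 := sq_add_one_of_mem_hypPlane hz
  have hy2 := hy.2
  have hz2 := hz.2
  have hz1 : 1 ≤ z 2 ^ 2 := by nlinarith [sq_nonneg (z 0), sq_nonneg (z 1)]
  have hcs : (y 0 * z 0 + y 1 * z 1) ^ 2 ≤ (y 0 ^ 2 + y 1 ^ 2) * (z 0 ^ 2 + z 1 ^ 2) := by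
    nlinarith [sq_nonneg (y 0 * z 1 - y 1 * z 0)]
  have hcs' : (y 0 ^ 2 + y 1 ^ 2) * (z 0 ^ 2 + z 1 ^ 2) ≤ y 2 ^ 2 * (z 2 ^ 2 - 1) := by
    have : z 0 ^ 2 + z 1 ^ 2 = z 2 ^ 2 - 1 := by linarith
    rw [this]
    gcongr
    linarith
  have key : (2 * z 2 * (y 0 * z 0 + y 1 * z 1)) ^ 2 ≤ (y 2 * (2 * z 2 ^ 2 - 1)) ^ 2 := by
    calc (2 * z 2 * (y 0 * z 0 + y 1 * z 1)) ^ 2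
        = 4 * z 2 ^ 2 * (y 0 * z 0 + y 1 * z 1) ^ 2 := by ring
      _ ≤ 4 * z 2 ^ 2 * (y 2 ^ 2 * (z 2 ^ 2 - 1)) := by
          gcongr
          exact hcs.trans hcs'
      _ ≤ (y 2 * (2 * z 2 ^ 2 - 1)) ^ 2 := by nlinarith [sq_nonneg (y 2)]
  have := (abs_le_of_sq_le_sq' key (by apply mul_nonneg hy2.le; linarith)).2
  simp only [lorB]
  nlinarith

theorem IsSurfaceGroup.finite_bounded {G : Subgroup (GL (Fin 3) ℝ)} (hG : IsSurfaceGroup G)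
    (R : ℝ) : {g | g ∈ G ∧ ∃ x ∈ hypPlane, x 2 ≤ R ∧ lact g x 2 ≤ R}.Finite := by
  have := hG.discrete
  have hfin : ({g : GL (Fin 3) ℝ | (∀ i j, (g : Matrix (Fin 3) (Fin 3) ℝ) i j ∈
      Icc (-(2 * R * R + 1)) (2 * R * R + 1)) ∧
      ∀ i j, ((g⁻¹ : GL (Fin 3) ℝ) : Matrix (Fin 3) (Fin 3) ℝ) i j ∈
        Icc (-(2 * R * R + 1)) (2 * R * R + 1)} ∩ (G : Set (GL (Fin 3) ℝ))).Finite := by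
    apply IsCompact.finite
    · exact (isCompact_bounded_units _).inter_right Subgroup.isClosed_of_discrete
    · exact IsDiscrete.mono ⟨hG.discrete⟩ inter_subset_right
  refine hfin.subset ?_
  rintro g ⟨hg, x, hx, hxR, hgxR⟩
  have hgS := hG.le_SO hg
  have hy := lact_mem_hypPlane hgS single_two_mem_hypPlane
  have hz := lact_mem_hypPlane hgS hx
  -- The corner entry of `g` is the height of the image of the apex, which is as far from `g x` as
  -- the apex is from `x`.
  have h22 := apply_two_le hy hz
  rw [lorB_lact hgS, lorB_single, lact_single] at h22
  simp at h22
  have hpos := hy.2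
  rw [lact_single] at hpos
  have hM : |(g : Matrix (Fin 3) (Fin 3) ℝ) 2 2| ≤ 2 * R * R := by
    rw [abs_of_pos hpos]
    refine h22.trans ?_
    have := hx.2
    have := hz.2
    gcongr
    linarith
  refine ⟨⟨fun i j => ?_, fun i j => ?_⟩, hg⟩
  · exact abs_le.1 ((abs_apply_le hgS i j).trans (by linarith))
  · refine abs_le.1 ?_
    rw [abs_inv_apply hgS]
    exact (abs_apply_le hgS j i).trans (by linarith)

theorem IsSurfaceGroup.eq_one_of_fixed {G : Subgroup (GL (Fin 3) ℝ)} (hG : IsSurfaceGroup G)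
    {g : GL (Fin 3) ℝ} (hg : g ∈ G) {x : LVec} (hx : x ∈ hypPlane) (hfix : lact g x = x) :
    g = 1 := by
  by_contra h
  exact not_isHypElt_of_fixed (hG.le_SO hg) hx hfix (hG.hyperbolic g hg h)

/-! ### Axes -/

theorem IsAxis.translate_eq {g : GL (Fin 3) ℝ} {p v : LVec} (h : IsAxis g p v) :
    lact g p = geod p v (transLen g) ∧ lact g v = geodVel p v (transLen g) := by
  have h0 := h.translate 0
  -- After cancelling the base point, the parameter 1 leaves `sinh 1` times the velocity; any
  -- nonzero parameter would serve.
  have h1 := h.translate 1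
  rw [zero_add, geod_zero] at h0
  refine ⟨h0, ?_⟩
  rw [add_comm, geod_add, lact_geod, h0] at h1
  simp only [geod, add_right_inj] at h1 ⊢
  exact smul_right_injective _ (by rw [Real.sinh_ne_zero]; norm_num) h1

theorem IsAxis.lact_normal {g : GL (Fin 3) ℝ} {p v : LVec} (h : IsAxis g p v) (hg : g ∈ lorSO) :
    lact g (lcross p v) = lcross p v := by
  rw [lact_lcross hg, h.translate_eq.1, h.translate_eq.2, lcross_geod]

theorem IsAxis.zpow_translate {g : GL (Fin 3) ℝ} {p v : LVec} (h : IsAxis g p v) (m : ℤ) (s : ℝ) :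
    lact (g ^ m) (geod p v s) = geod p v (s + m * transLen g) := by
  induction m using Int.induction_on generalizing s with
  | zero => simp [lact_one]
  | succ m ih =>
    rw [_root_.zpow_add_one, lact_mul, h.translate, ih]
    push_cast
    congr 1; ring
  | pred m ih =>
    have : geod p v s = lact g (geod p v (s - transLen g)) := by
      rw [h.translate, sub_add_cancel]
    rw [_root_.zpow_sub_one, lact_mul, this, lact_inv_lact, ih]
    push_cast
    congr 1; ring

theorem IsAxis.zpow_normal {g : GL (Fin 3) ℝ} {p v : LVec} (h : IsAxis g p v) (hg : g ∈ lorSO)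
    (m : ℤ) : lact (g ^ m) (lcross p v) = lcross p v := by
  induction m using Int.induction_on with
  | zero => simp [lact_one]
  | succ m ih => rw [_root_.zpow_add_one, lact_mul, h.lact_normal hg, ih]
  | pred m ih =>
    have : lact g⁻¹ (lcross p v) = lcross p v := by
      nth_rw 1 [← h.lact_normal hg]
      rw [lact_inv_lact]
    rw [_root_.zpow_sub_one, lact_mul, this, ih]

theorem one_le_neg_lorB {x y : LVec} (hx : x ∈ hypPlane) (hy : y ∈ hypPlane) :
    1 ≤ -lorB x y := by
  linarith [lorB_le_neg_one hx hy]

theorem transLen_nonneg {g : GL (Fin 3) ℝ} (hg : g ∈ lorSO) : 0 ≤ transLen g :=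
  Real.iInf_nonneg fun x => Real.arcosh_nonneg (one_le_neg_lorB x.2 (lact_mem_hypPlane hg x.2))

theorem IsAxis.transLen_pos {G : Subgroup (GL (Fin 3) ℝ)} (hG : IsSurfaceGroup G)
    {g : GL (Fin 3) ℝ} (hg : g ∈ G) (hne : g ≠ 1) {p v : LVec} (h : IsAxis g p v) :
    0 < transLen g := by
  refine lt_of_le_of_ne (transLen_nonneg (hG.le_SO hg)) fun h0 => hne ?_
  refine hG.eq_one_of_fixed hg h.base_mem ?_
  rw [h.translate_eq.1, ← h0, geod_zero]

/-- `geod p v` is the axis of the non-trivial element `h` of the surface group `G`, and it covers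
a simple closed geodesic. -/
structure IsSimpleAxis (G : Subgroup (GL (Fin 3) ℝ)) (h : GL (Fin 3) ℝ) (p v : LVec) : Prop where
  group : IsSurfaceGroup G
  mem : h ∈ G
  ne_one : h ≠ 1
  axis : IsAxis h p v
  simple : IsSimpleLoop G h p v

/-- The translates of the oriented normal vector of a geodesic. -/
def liftNormals (G : Subgroup (GL (Fin 3) ℝ)) (n : LVec) : Set LVec := {m | ∃ k ∈ G, m = lact k n}

theorem lact_mem_liftNormals {G : Subgroup (GL (Fin 3) ℝ)} {n m : LVec} {g : GL (Fin 3) ℝ}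
    (hg : g ∈ G) (hm : m ∈ liftNormals G n) : lact g m ∈ liftNormals G n := by
  obtain ⟨k, hk, rfl⟩ := hm
  exact ⟨g * k, G.mul_mem hg hk, by rw [lact_mul]⟩

theorem self_mem_liftNormals (G : Subgroup (GL (Fin 3) ℝ)) (n : LVec) : n ∈ liftNormals G n :=
  ⟨1, G.one_mem, by rw [lact_one]⟩

theorem bijOn_lact_liftNormals {G : Subgroup (GL (Fin 3) ℝ)} (n : LVec) {g : GL (Fin 3) ℝ}
    (hg : g ∈ G) : BijOn (lact g) (liftNormals G n) (liftNormals G n) := by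
  refine ⟨fun m hm => lact_mem_liftNormals hg hm, fun a _ b _ hab => ?_, fun m hm =>
    ⟨lact g⁻¹ m, lact_mem_liftNormals (G.inv_mem hg) hm, lact_inv _ _⟩⟩
  rw [← lact_inv_lact g a, ← lact_inv_lact g b]
  exact congrArg _ hab

/-! ### Disjointness and local finiteness of the translates of a simple axis -/

namespace IsSimpleAxis

variable {G : Subgroup (GL (Fin 3) ℝ)} {h : GL (Fin 3) ℝ} {p v : LVec}
  (H : IsSimpleAxis G h p v)
include H

theorem mem_SO : h ∈ lorSO := H.group.le_SO H.mem

theorem tangent : IsUnitTangent p v := H.axis.isUnitTangent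

theorem transLen_pos : 0 < transLen h := H.axis.transLen_pos H.group H.mem H.ne_one

theorem exists_zpow_of_lact_geod {g : GL (Fin 3) ℝ} (hg : g ∈ G) {s t : ℝ}
    (hst : lact g (geod p v s) = geod p v t) : ∃ m : ℤ, g = h ^ m ∧ t = s + m * transLen h := by
  obtain ⟨m, hm⟩ := H.simple g hg s t hst
  refine ⟨m, ?_, hm⟩
  rw [hm, ← H.axis.zpow_translate] at hst
  have h1 : lact ((h ^ m)⁻¹ * g) (geod p v s) = geod p v s := by
    rw [lact_mul, hst, lact_inv_lact]
  have h2 := H.group.eq_one_of_fixed (G.mul_mem (G.inv_mem (G.zpow_mem H.mem m)) hg)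
    (H.tangent.geod s).base_mem h1
  exact (inv_mul_eq_one.1 h2).symm

theorem exists_zpow_of_lact_eq {k k' : GL (Fin 3) ℝ} (hk : k ∈ G) (hk' : k' ∈ G) {s t : ℝ}
    (hst : lact k (geod p v s) = lact k' (geod p v t)) :
    ∃ m : ℤ, k = k' * h ^ m ∧ t = s + m * transLen h := by
  have h1 : lact (k'⁻¹ * k) (geod p v s) = geod p v t := by
    rw [lact_mul, hst, lact_inv_lact]
  obtain ⟨m, hm, ht⟩ := H.exists_zpow_of_lact_geod (G.mul_mem (G.inv_mem hk') hk) h1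
  exact ⟨m, by rw [← hm, mul_inv_cancel_left], ht⟩

/-- A point of a translate of the axis has a representative in the fundamental interval. -/
theorem exists_lact_geod_Ico {k : GL (Fin 3) ℝ} (hk : k ∈ G) {x : LVec} (hx : x ∈ hypPlane)
    (h0 : lorB (lact k (lcross p v)) x = 0) :
    ∃ k' ∈ G, ∃ t ∈ Ico 0 (transLen h), x = lact k' (geod p v t) ∧
      lact k' (lcross p v) = lact k (lcross p v) := by
  have hkS := H.group.le_SO hk
  have hx' := lact_mem_hypPlane (lorSO.inv_mem hkS) hx
  rw [lorB_lact_left hkS] at h0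
  obtain ⟨t, ht⟩ := H.tangent.exists_geod_eq hx' h0
  obtain ⟨m, hm, -⟩ := existsUnique_add_zsmul_mem_Ico H.transLen_pos t 0
  refine ⟨k * h ^ (-m), G.mul_mem hk (G.zpow_mem H.mem _), _, by simpa using hm, ?_, ?_⟩
  · rw [lact_mul, H.axis.zpow_translate, Int.cast_neg, neg_mul,
      add_neg_cancel_right, ← ht, lact_inv]
  · rw [lact_mul, H.axis.zpow_normal H.mem_SO]

/-- Distinct translates of the axis are disjoint. -/
theorem eq_of_mem {n n' : LVec} (hn : n ∈ liftNormals G (lcross p v))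
    (hn' : n' ∈ liftNormals G (lcross p v)) {x : LVec} (hx : x ∈ hypPlane) (h0 : lorB n x = 0)
    (h0' : lorB n' x = 0) : n = n' := by
  obtain ⟨k, hk, rfl⟩ := hn
  obtain ⟨k', hk', rfl⟩ := hn'
  obtain ⟨l, hl, s, -, hs, hln⟩ := H.exists_lact_geod_Ico hk hx h0
  obtain ⟨l', hl', s', -, hs', hln'⟩ := H.exists_lact_geod_Ico hk' hx h0'
  obtain ⟨m, rfl, -⟩ := H.exists_zpow_of_lact_eq hl hl' (hs.symm.trans hs')
  rw [← hln, ← hln', lact_mul, H.axis.zpow_normal H.mem_SO]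

/-- The translates of the axis are locally finite. -/
theorem finite_lifts (R : ℝ) :
    {n ∈ liftNormals G (lcross p v) | ∃ x ∈ hypPlane, x 2 ≤ R ∧ lorB n x = 0}.Finite := by
  -- The second term bounds the height on one period of the axis: a lift meeting the region comes
  -- from an element moving a point of that period into it.
  set R' := max R (Real.cosh (transLen h) * (|p 2| + |v 2|))
  refine ((H.group.finite_bounded R').image fun k => lact k (lcross p v)).subset ?_
  rintro _ ⟨⟨k, hk, rfl⟩, x, hx, hxR, h0⟩
  obtain ⟨l, hl, s, hs, hxs, hln⟩ := H.exists_lact_geod_Ico hk hx h0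
  refine ⟨l, ⟨hl, geod p v s, (H.tangent.geod s).base_mem, ?_, ?_⟩, hln⟩
  · refine le_trans ?_ (le_max_right _ _)
    have h1 : Real.cosh s ≤ Real.cosh (transLen h) := by
      rw [Real.cosh_le_cosh, abs_of_nonneg hs.1, abs_of_nonneg H.transLen_pos.le]
      exact hs.2.le
    have h2 : |Real.sinh s| ≤ Real.cosh s := by
      rw [← Real.cosh_abs s, Real.abs_sinh]
      exact (Real.sinh_lt_cosh _).le
    calc geod p v s 2 = Real.cosh s * p 2 + Real.sinh s * v 2 := by simp [geod]
      _ ≤ Real.cosh s * |p 2| + |Real.sinh s| * |v 2| := by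
        rw [← abs_mul]
        gcongr
        · exact le_abs_self _
        · exact le_abs_self _
      _ ≤ Real.cosh (transLen h) * |p 2| + Real.cosh (transLen h) * |v 2| := by
        gcongr
        exact h2.trans h1
      _ = _ := by ring
  · rw [← hxs]
    exact hxR.trans (le_max_left _ _)

/-- Near a point of the hyperbolic plane there are no lifts but those through the point. -/
theorem eventually_lorB_ne {x : LVec} :
    ∀ᶠ y in 𝓝 x, ∀ n ∈ liftNormals G (lcross p v), lorB n x ≠ 0 → y ∈ hypPlane →
      lorB n y ≠ 0 := by
  have hfin := H.finite_lifts (x 2 + 1)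
  have h1 : ∀ᶠ y : LVec in 𝓝 x, y 2 < x 2 + 1 :=
    (continuous_apply 2).continuousAt.eventually_lt continuousAt_const (by linarith)
  have h2 : ∀ᶠ y : LVec in 𝓝 x, ∀ n ∈ {n ∈ liftNormals G (lcross p v) |
      ∃ x' ∈ hypPlane, x' 2 ≤ x 2 + 1 ∧ lorB n x' = 0}, lorB n x ≠ 0 → lorB n y ≠ 0 := by
    rw [hfin.eventually_all]
    intro n _
    by_cases h0 : lorB n x = 0
    · simp [h0]
    · filter_upwards [(continuous_lorB n).continuousAt.eventually_ne h0] with y hy _ using hy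
  filter_upwards [h1, h2] with y hy1 hy2 n hn hnx hyH hny
  exact hy2 n ⟨hn, y, hyH, hy1.le, hny⟩ hnx hny

end IsSimpleAxis

/-! ### The crossing cocycle -/

/-- Radial projection of timelike vectors to the hyperboloid. -/
def radial (z : LVec) : LVec := (√(-lorB z z))⁻¹ • z

theorem lorB_convex_le {x y : LVec} (hx : x ∈ hypPlane) (hy : y ∈ hypPlane) {a b : ℝ}
    (ha : 0 ≤ a) (hb : 0 ≤ b) (hab : a + b = 1) :
    lorB (a • x + b • y) (a • x + b • y) ≤ -1 := by
  have h1 := lorB_le_neg_one hx hy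
  have h2 : lorB x x = -1 := hx.1
  have h3 : lorB y y = -1 := hy.1
  simp only [lorB_add_left, lorB_add_right, lorB_smul_left, lorB_smul_right, h2, h3, lorB_comm y x]
  obtain rfl : b = 1 - a := by linarith
  nlinarith [mul_nonneg ha hb]

theorem radial_mem {z : LVec} (hz : lorB z z < 0) (hz2 : 0 < z 2) : radial z ∈ hypPlane := by
  have hpos : 0 < √(-lorB z z) := Real.sqrt_pos.2 (by linarith)
  have hsq : √(-lorB z z) ^ 2 = -lorB z z := Real.sq_sqrt (by linarith)
  refine ⟨?_, ?_⟩
  · rw [radial, lorB_smul_left, lorB_smul_right]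
    field_simp
    linarith
  · simp only [radial, Pi.smul_apply, smul_eq_mul]
    positivity

theorem lorB_radial (n z : LVec) : lorB n (radial z) = (√(-lorB z z))⁻¹ * lorB n z :=
  lorB_smul_right _ _ _

theorem radial_of_mem {x : LVec} (hx : x ∈ hypPlane) : radial x = x := by
  have h : lorB x x = -1 := hx.1
  simp [radial, h]

/-- A convex combination of points of the hyperboloid has `-B(z,z) ≥ 1`, so radial projection only
lowers its height. The geodesic segment thus stays below the height of its ends. -/
theorem exists_lorB_eq_zero {n x y : LVec} {R : ℝ} (hx : x ∈ hypPlane) (hy : y ∈ hypPlane)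
    (hxR : x 2 ≤ R) (hyR : y 2 ≤ R) (h1 : lorB n x ≤ 0) (h2 : 0 ≤ lorB n y) :
    ∃ z ∈ hypPlane, z 2 ≤ R ∧ lorB n z = 0 := by
  rcases eq_or_lt_of_le h1 with h0 | h0
  · exact ⟨x, hx, hxR, h0⟩
  have hd : 0 < lorB n y - lorB n x := by linarith
  set a := lorB n y / (lorB n y - lorB n x) with ha
  set b := -lorB n x / (lorB n y - lorB n x) with hb
  have ha0 : 0 ≤ a := div_nonneg h2 hd.le
  have hb0 : 0 ≤ b := div_nonneg (by linarith) hd.le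
  have hab : a + b = 1 := by rw [ha, hb]; field_simp; ring
  have hle := lorB_convex_le hx hy ha0 hb0 hab
  set z := a • x + b • y with hz
  have hz2 : z 2 = a * x 2 + b * y 2 := by simp [hz]
  have hzR : z 2 ≤ R := by
    rw [hz2]
    calc a * x 2 + b * y 2 ≤ a * R + b * R := by gcongr
      _ = R := by rw [← add_mul, hab, one_mul]
  have hzpos : 0 < z 2 := by
    rw [hz2]
    rcases eq_or_lt_of_le ha0 with h | h
    · have : b = 1 := by linarith
      rw [← h, this]; linarith [hy.2]
    · have := mul_pos h hx.2
      have := mul_nonneg hb0 hy.2.le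
      linarith
  refine ⟨radial z, radial_mem (by linarith) hzpos, ?_, ?_⟩
  · have h1 : 1 ≤ √(-lorB z z) := Real.one_le_sqrt.2 (by linarith)
    simp only [radial, Pi.smul_apply, smul_eq_mul]
    exact (mul_le_of_le_one_left hzpos.le (inv_le_one_of_one_le₀ h1)).trans hzR
  · have h3 : lorB n z = 0 := by
      rw [hz, lorB_add_right, lorB_smul_right, lorB_smul_right, ha, hb]
      field_simp
      ring
    rw [lorB_radial, h3, mul_zero]

open Classical in
/-- The indicator of the left side of the geodesic with normal `n`, for a point `P.1` pushed
infinitesimally in the direction `-P.2`. -/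
def leftSide (n : LVec) (P : LVec × LVec) : ℝ :=
  if 0 < lorB n P.1 ∨ (lorB n P.1 = 0 ∧ lorB n P.2 < 0) then 1 else 0

/-- The signed sum of the normals of the lifts that separate `P` from `Q`. -/
def crossSum (N : Set LVec) (P Q : LVec × LVec) : LVec :=
  ∑ᶠ n ∈ N, (leftSide n Q - leftSide n P) • n

theorem leftSide_of_pos {n : LVec} {P : LVec × LVec} (h : 0 < lorB n P.1) : leftSide n P = 1 :=
  if_pos (Or.inl h)

theorem leftSide_of_neg {n : LVec} {P : LVec × LVec} (h : lorB n P.1 < 0) : leftSide n P = 0 :=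
  if_neg (by rintro (h' | ⟨h', -⟩) <;> linarith)

theorem leftSide_of_zero_of_neg {n : LVec} {P : LVec × LVec} (h : lorB n P.1 = 0)
    (h' : lorB n P.2 < 0) : leftSide n P = 1 :=
  if_pos (Or.inr ⟨h, h'⟩)

theorem leftSide_of_zero_of_nonneg {n : LVec} {P : LVec × LVec} (h : lorB n P.1 = 0)
    (h' : 0 ≤ lorB n P.2) : leftSide n P = 0 :=
  if_neg (by rintro (h'' | ⟨-, h''⟩) <;> linarith)

theorem leftSide_lact {g : GL (Fin 3) ℝ} (hg : g ∈ lorSO) (n : LVec) (P : LVec × LVec) :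
    leftSide (lact g n) (lact g P.1, lact g P.2) = leftSide n P := by
  simp only [leftSide, lorB_lact hg]

namespace IsSimpleAxis

variable {G : Subgroup (GL (Fin 3) ℝ)} {h : GL (Fin 3) ℝ} {p v : LVec}
  (H : IsSimpleAxis G h p v)
include H

theorem finite_separating {P Q : LVec × LVec} (hP : P.1 ∈ hypPlane) (hQ : Q.1 ∈ hypPlane) :
    {n ∈ liftNormals G (lcross p v) | leftSide n Q ≠ leftSide n P}.Finite := by
  refine (H.finite_lifts (max (P.1 2) (Q.1 2))).subset ?_
  rintro n ⟨hn, hne⟩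
  refine ⟨hn, ?_⟩
  rcases le_total (lorB n P.1) 0 with h1 | h1 <;> rcases le_total (lorB n Q.1) 0 with h2 | h2
  · rcases eq_or_lt_of_le h1 with h3 | h3
    · exact ⟨_, hP, le_max_left _ _, h3⟩
    · rcases eq_or_lt_of_le h2 with h4 | h4
      · exact ⟨_, hQ, le_max_right _ _, h4⟩
      · exact absurd (by rw [leftSide_of_neg h3, leftSide_of_neg h4]) hne
  · exact exists_lorB_eq_zero hP hQ (le_max_left _ _) (le_max_right _ _) h1 h2
  · exact exists_lorB_eq_zero hQ hP (le_max_right _ _) (le_max_left _ _) h2 h1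
  · rcases eq_or_lt_of_le h1 with h3 | h3
    · exact ⟨_, hP, le_max_left _ _, h3.symm⟩
    · rcases eq_or_lt_of_le h2 with h4 | h4
      · exact ⟨_, hQ, le_max_right _ _, h4.symm⟩
      · exact absurd (by rw [leftSide_of_pos h3, leftSide_of_pos h4]) hne

/-- A `finsum` with infinite support is zero by default; every manipulation of `crossSum` rests on
this finiteness. -/
theorem finite_support {P Q : LVec × LVec} (hP : P.1 ∈ hypPlane) (hQ : Q.1 ∈ hypPlane) :
    (liftNormals G (lcross p v) ∩
      Function.support fun n => (leftSide n Q - leftSide n P) • n).Finite := by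
  refine (H.finite_separating hP hQ).subset ?_
  rintro n ⟨hn, hne⟩
  refine ⟨hn, fun h0 => hne ?_⟩
  simp [h0]

theorem crossSum_add {P Q R : LVec × LVec} (hP : P.1 ∈ hypPlane) (hQ : Q.1 ∈ hypPlane)
    (hR : R.1 ∈ hypPlane) : crossSum (liftNormals G (lcross p v)) P Q +
      crossSum (liftNormals G (lcross p v)) Q R = crossSum (liftNormals G (lcross p v)) P R := by
  unfold crossSum
  rw [← finsum_mem_add_distrib' (H.finite_support hP hQ) (H.finite_support hQ hR)]
  refine finsum_mem_congr rfl fun n _ => ?_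
  module

theorem lact_crossSum {g : GL (Fin 3) ℝ} (hg : g ∈ G) {P Q : LVec × LVec} (hP : P.1 ∈ hypPlane)
    (hQ : Q.1 ∈ hypPlane) : lact g (crossSum (liftNormals G (lcross p v)) P Q) =
      crossSum (liftNormals G (lcross p v)) (lact g P.1, lact g P.2) (lact g Q.1, lact g Q.2) := by
  have h1 := (lactHom g).map_finsum_mem' (H.finite_support hP hQ)
  refine h1.trans ?_
  refine finsum_mem_eq_of_bijOn (lact g) (bijOn_lact_liftNormals _ hg) fun n _ => ?_
  rw [leftSide_lact (H.group.le_SO hg), leftSide_lact (H.group.le_SO hg)]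
  exact lact_smul _ _ _

theorem lorB_crossSum {P Q : LVec × LVec} (hP : P.1 ∈ hypPlane)
    (hQ : Q.1 ∈ hypPlane) (y : LVec) : lorB (crossSum (liftNormals G (lcross p v)) P Q) y =
      ∑ᶠ n ∈ liftNormals G (lcross p v), (leftSide n Q - leftSide n P) * lorB n y := by
  have h1 := (lorBHom y).map_finsum_mem' (H.finite_support hP hQ)
  refine h1.trans (finsum_mem_congr rfl fun n _ => ?_)
  exact lorB_smul_left _ _ _

theorem isLCocycle_crossSum : IsLCocycle G fun g => crossSum (liftNormals G (lcross p v)) (p, 0)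
    (lact (g : GL (Fin 3) ℝ) p, 0) := by
  intro g k
  have hp := H.tangent.base_mem
  have hk := lact_mem_hypPlane (H.group.le_SO k.2) hp
  have hg := lact_mem_hypPlane (H.group.le_SO g.2) hp
  have hgk := lact_mem_hypPlane (H.group.le_SO g.2) hk
  simp only [Subgroup.coe_mul, lact_mul]
  have hact := H.lact_crossSum g.2 (P := (p, 0)) (Q := (lact (k : GL (Fin 3) ℝ) p, 0)) hp hk
  rw [hact, lact_zero, add_comm]
  exact (H.crossSum_add (P := (p, 0)) (Q := (_, 0)) (R := (_, 0)) hp hg hgk).symm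

end IsSimpleAxis

/-! ### The pieces of the complement of a separating geodesic -/

/-- `S` is one of two closed sets `S`, `S'` that cover the hyperbolic plane and meet only in the
geodesics with normals in `N`, and it lies to the left of these geodesics if `ε = 1`, to the right
if `ε = -1`. -/
structure IsSide (N S S' : Set LVec) (ε : ℝ) : Prop where
  closed : IsClosed S
  subset : S ⊆ hypPlane
  cover : hypPlane ⊆ S ∪ S'
  inter : ∀ x ∈ S, x ∈ S' → ∃ n ∈ N, lorB n x = 0
  lift_mem : ∀ n ∈ N, ∀ x ∈ hypPlane, lorB n x = 0 → x ∈ S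
  near : ∀ n ∈ N, ∀ x ∈ hypPlane, lorB n x = 0 →
    ∀ᶠ y in 𝓝 x, y ∈ hypPlane → 0 < ε * lorB n y → y ∈ S

theorem JoinedIn.lact_image {S : Set LVec} {g : GL (Fin 3) ℝ} (hS : ∀ x ∈ S, lact g x ∈ S)
    {x y : LVec} (hxy : JoinedIn S x y) : JoinedIn S (lact g x) (lact g y) := by
  obtain ⟨γ, hγ⟩ := hxy
  exact ⟨γ.map (continuous_lact g), fun t => hS _ (hγ t)⟩

/-- Any neighbourhood of a point of the hyperbolic plane contains the geodesic segments from this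
point to all points of a smaller neighbourhood. -/
theorem eventually_radial_segment {x : LVec} (hx : x ∈ hypPlane) {U : LVec → Prop}
    (hU : ∀ᶠ z in 𝓝 x, U z) :
    ∀ᶠ y in 𝓝 x, ∀ t ∈ Icc (0 : ℝ) 1, U (radial ((1 - t) • x + t • y)) := by
  have hB : lorB x x = -1 := hx.1
  have hcont : ContinuousAt radial x := by
    have h1 : Continuous fun z : LVec => -lorB z z := by unfold lorB; fun_prop
    have h2 : ContinuousAt (fun z : LVec => (√(-lorB z z))⁻¹) x := by
      refine (Real.continuous_sqrt.comp h1).continuousAt.inv₀ ?_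
      simp [hB]
    exact h2.smul continuousAt_id
  have hU' : ∀ᶠ z in 𝓝 x, U (radial z) := by
    apply hcont.eventually
    rwa [radial_of_mem hx]
  obtain ⟨r, hr, hball⟩ := Metric.eventually_nhds_iff_ball.1 hU'
  filter_upwards [Metric.ball_mem_nhds x hr] with y hy t ht
  exact hball _ (convex_ball x r (Metric.mem_ball_self hr) hy (by linarith [ht.2]) ht.1 (by ring))

theorem convex_mem {x y : LVec} (hx : x ∈ hypPlane) (hy : y ∈ hypPlane) {t : ℝ}
    (ht : t ∈ Icc (0 : ℝ) 1) : lorB ((1 - t) • x + t • y) ((1 - t) • x + t • y) ≤ -1 ∧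
      0 < ((1 - t) • x + t • y) 2 := by
  refine ⟨lorB_convex_le hx hy (by linarith [ht.2]) ht.1 (by ring), ?_⟩
  simp only [Pi.add_apply, Pi.smul_apply, smul_eq_mul]
  rcases eq_or_lt_of_le ht.1 with h0 | h0
  · rw [← h0]; linarith [hx.2]
  · have := mul_pos h0 hy.2
    have := mul_nonneg (sub_nonneg.2 ht.2) hx.2.le
    linarith

theorem joinedIn_of_radial {S : Set LVec} {x y : LVec} (hx : x ∈ hypPlane) (hy : y ∈ hypPlane)
    (hS : ∀ t ∈ Icc (0 : ℝ) 1, radial ((1 - t) • x + t • y) ∈ S) : JoinedIn S x y := by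
  refine JoinedIn.ofLine (f := fun t => radial ((1 - t) • x + t • y)) ?_ ?_ ?_ ?_
  · have h1 : Continuous fun t : ℝ => -lorB ((1 - t) • x + t • y) ((1 - t) • x + t • y) := by
      simp only [lorB, Pi.add_apply, Pi.smul_apply, smul_eq_mul]; fun_prop
    have h2 : ContinuousOn (fun t : ℝ =>
        (√(-lorB ((1 - t) • x + t • y) ((1 - t) • x + t • y)))⁻¹) (Icc 0 1) := by
      refine (Real.continuous_sqrt.comp h1).continuousOn.inv₀ fun t ht => ?_
      exact (Real.sqrt_pos.2 (by linarith [(convex_mem hx hy ht).1])).ne'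
    exact h2.smul (by fun_prop)
  · simp [radial_of_mem hx]
  · simp [radial_of_mem hy]
  · rintro _ ⟨t, ht, rfl⟩
    exact hS t ht

theorem isPreconnected_hypPlane : IsPreconnected hypPlane := by
  refine IsPathConnected.isConnected ⟨_, single_two_mem_hypPlane, fun {y} hy => ?_⟩ |>.isPreconnected
  refine joinedIn_of_radial single_two_mem_hypPlane hy fun t ht => ?_
  have := convex_mem single_two_mem_hypPlane hy ht
  exact radial_mem (by linarith [this.1]) this.2

namespace IsSimpleAxis

variable {G : Subgroup (GL (Fin 3) ℝ)} {h : GL (Fin 3) ℝ} {p v : LVec}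
  (H : IsSimpleAxis G h p v)
include H

theorem eventually_eq_of_mem {x n : LVec} (hx : x ∈ hypPlane)
    (hn : n ∈ liftNormals G (lcross p v)) (h0 : lorB n x = 0) :
    ∀ᶠ y in 𝓝 x, ∀ n' ∈ liftNormals G (lcross p v), y ∈ hypPlane → lorB n' y = 0 → n' = n := by
  filter_upwards [H.eventually_lorB_ne (x := x)] with y hy n' hn' hyH h0'
  by_contra hne
  exact hy n' hn' (fun h1 => hne (H.eq_of_mem hn' hn hx h1 h0)) hyH h0'

variable {S S' : Set LVec} {ε : ℝ} (hS : IsSide (liftNormals G (lcross p v)) S S' ε)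
include hS

/-- A path in the other piece does not enter the side on which `S` lies of any lift. -/
theorem side_const {x y n : LVec} (hS' : S' ⊆ hypPlane) (hxy : JoinedIn S' x y)
    (hn : n ∈ liftNormals G (lcross p v)) : 0 < ε * lorB n x ↔ 0 < ε * lorB n y := by
  obtain ⟨γ, hγ⟩ := hxy
  have hcont : Continuous fun t => ε * lorB n (γ t) :=
    continuous_const.mul ((continuous_lorB n).comp γ.continuous)
  have hclopen : IsClopen {t | 0 < ε * lorB n (γ t)} := by
    refine ⟨?_, isOpen_lt continuous_const hcont⟩
    rw [← isOpen_compl_iff, isOpen_iff_mem_nhds]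
    intro t ht
    simp only [mem_compl_iff, mem_ofPred_eq, not_lt] at ht
    -- On the lift itself: nearby path points on the `ε` side would lie in both pieces, hence on
    -- some lift. The only lift nearby is `n`, and a point of `n` is not strictly on a side. Off the
    -- lift, the condition is open.
    rcases eq_or_lt_of_le ht with h0 | h0
    · by_cases hε : ε = 0
      · simp [hε]
      have h1 : lorB n (γ t) = 0 := (mul_eq_zero.1 h0).resolve_left hε
      have hH := hS' (hγ t)
      have hev := (hS.near n hn _ hH h1).and (H.eventually_eq_of_mem hH hn h1)
      filter_upwards [γ.continuous.continuousAt.eventually hev] with s hs hpos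
      have hsH := hS' (hγ s)
      obtain ⟨n', hn', h0'⟩ := hS.inter _ (hs.1 hsH hpos) (hγ s)
      obtain rfl := hs.2 n' hn' hsH h0'
      simp [h0'] at hpos
    · filter_upwards [hcont.continuousAt.eventually_lt continuousAt_const h0] with s hs
      simpa using hs.le
  rcases isClopen_iff.1 hclopen with h1 | h1
  · have h2 : (0 : unitInterval) ∉ {t | 0 < ε * lorB n (γ t)} := by simp [h1]
    have h3 : (1 : unitInterval) ∉ {t | 0 < ε * lorB n (γ t)} := by simp [h1]
    simp only [mem_ofPred_eq, γ.source, γ.target] at h2 h3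
    exact iff_of_false h2 h3
  · have h2 : (0 : unitInterval) ∈ {t | 0 < ε * lorB n (γ t)} := by simp [h1]
    have h3 : (1 : unitInterval) ∈ {t | 0 < ε * lorB n (γ t)} := by simp [h1]
    simp only [mem_ofPred_eq, γ.source, γ.target] at h2 h3
    exact iff_of_true h2 h3

omit H hS in
theorem lorB_radial_segment (n x y : LVec) (t : ℝ) :
    lorB n (radial ((1 - t) • x + t • y)) =
      (√(-lorB ((1 - t) • x + t • y) ((1 - t) • x + t • y)))⁻¹ *
        ((1 - t) * lorB n x + t * lorB n y) := by
  rw [lorB_radial, lorB_add_right n, lorB_smul_right _ n, lorB_smul_right _ n]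

/-- The pieces are locally path-connected. -/
theorem eventually_joinedIn (hS' : IsSide (liftNormals G (lcross p v)) S' S (-ε)) (hε : ε ≠ 0)
    {x : LVec} (hx : x ∈ hypPlane) : ∀ᶠ y in 𝓝 x, y ∈ S → JoinedIn S x y := by
  by_cases hxS : x ∈ S
  swap
  · filter_upwards [hS.closed.isOpen_compl.mem_nhds hxS] with y hy hyS
    exact absurd hyS hy
  by_cases hxS' : x ∈ S'
  swap
  · filter_upwards [eventually_radial_segment hx (hS'.closed.isOpen_compl.mem_nhds hxS')]
      with y hy hyS
    have hyH := hS.subset hyS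
    refine joinedIn_of_radial hx hyH fun t ht => ?_
    have hc := convex_mem hx hyH ht
    exact (hS.cover (radial_mem (by linarith [hc.1]) hc.2)).resolve_right (hy t ht)
  obtain ⟨n, hn, h0⟩ := hS.inter x hxS hxS'
  filter_upwards [eventually_radial_segment hx (hS.near n hn x hx h0), hS'.near n hn x hx h0,
    H.eventually_eq_of_mem hx hn h0] with y hy1 hy2 hy3 hyS
  have hyH := hS.subset hyS
  -- If `y` were strictly on the wrong side, it would lie in both pieces, hence on `n`. So the
  -- segment from `x` to `y` stays on the closed `ε` side of `n`.
  have hnonneg : 0 ≤ ε * lorB n y := by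
    by_contra! hneg
    obtain ⟨n', hn', h0'⟩ := hS.inter y hyS (hy2 hyH (by linarith))
    obtain rfl := hy3 n' hn' hyH h0'
    simp [h0'] at hneg
  refine joinedIn_of_radial hx hyH fun t ht => ?_
  have hc := convex_mem hx hyH ht
  have hrad := radial_mem (by linarith [hc.1]) hc.2
  have heq := lorB_radial_segment n x y t
  rw [h0, mul_zero, zero_add] at heq
  by_cases hzero : t * lorB n y = 0
  · rw [hzero, mul_zero] at heq
    exact hS.lift_mem n hn _ hrad heq
  · refine hy1 t ht hrad ?_
    rw [heq]
    have h1 : 0 < √(-lorB ((1 - t) • x + t • y) ((1 - t) • x + t • y)) :=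
      Real.sqrt_pos.2 (by linarith [hc.1])
    have h2 : 0 < ε * (t * lorB n y) := by
      refine lt_of_le_of_ne ?_ (mul_ne_zero hε hzero).symm
      have := mul_nonneg ht.1 hnonneg
      linarith
    have h3 := mul_pos (inv_pos.2 h1) h2
    linarith

omit hS in
theorem lorB_lact_normal_geod {k : GL (Fin 3) ℝ} (hk : k ∈ G) (s : ℝ) :
    lorB (lact k (lcross p v)) (lact k (geod p v s)) = 0 := by
  rw [lorB_lact (H.group.le_SO hk), ← lcross_geod p v s, lorB_lcross_left]

theorem joinedIn_lift {k : GL (Fin 3) ℝ} (hk : k ∈ G) (s : ℝ) :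
    JoinedIn S (lact k p) (lact k (geod p v s)) := by
  refine JoinedIn.ofLine (f := fun t => lact k (geod p v (t * s))) ?_ ?_ ?_ ?_
  · exact ((continuous_lact k).comp ((continuous_geod p v).comp
      (continuous_id.mul continuous_const))).continuousOn
  · simp [geod_zero]
  · simp
  · rintro _ ⟨t, -, rfl⟩
    exact hS.lift_mem _ ⟨k, hk, rfl⟩ _ (lact_mem_hypPlane (H.group.le_SO hk)
      (H.tangent.geod _).base_mem) (H.lorB_lact_normal_geod hk _)

end IsSimpleAxis

/-! ### From a separating geodesic to its two sides -/

section Separation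

variable {G : Subgroup (GL (Fin 3) ℝ)} {h : GL (Fin 3) ℝ} {p v : LVec}
  (H : IsSimpleAxis G h p v) {S₁ S₂ : Set LVec} (hsep : SeparatesInto G p v S₁ S₂)
include H

theorem IsSimpleAxis.mem_fullLift {x : LVec} :
    x ∈ fullLift G p v ↔ x ∈ hypPlane ∧ ∃ n ∈ liftNormals G (lcross p v), lorB n x = 0 := by
  constructor
  · rintro ⟨g, hg, s, rfl⟩
    exact ⟨lact_mem_hypPlane (H.group.le_SO hg) (H.tangent.geod s).base_mem, _, ⟨g, hg, rfl⟩,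
      H.lorB_lact_normal_geod hg s⟩
  · rintro ⟨hx, _, ⟨k, hk, rfl⟩, h0⟩
    obtain ⟨l, hl, s, -, hs, -⟩ := H.exists_lact_geod_Ico hk hx h0
    exact ⟨l, hl, s, hs⟩

/-- Invariance under `G` carries the local condition from the axis to all of its translates. -/
theorem IsSimpleAxis.near_of_near {S : Set LVec} {ε : ℝ} (hinv : ∀ g ∈ G, ∀ x ∈ S, lact g x ∈ S)
    (hnear : ∀ s, ∀ᶠ y in 𝓝 (geod p v s), y ∈ hypPlane → 0 < ε * lorB (lcross p v) y → y ∈ S)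
    {n x : LVec} (hn : n ∈ liftNormals G (lcross p v)) (hx : x ∈ hypPlane) (h0 : lorB n x = 0) :
    ∀ᶠ y in 𝓝 x, y ∈ hypPlane → 0 < ε * lorB n y → y ∈ S := by
  obtain ⟨k, hk, rfl⟩ := hn
  obtain ⟨l, hl, s, -, rfl, hln⟩ := H.exists_lact_geod_Ico hk hx h0
  have hcont := (continuous_lact l⁻¹).continuousAt (x := lact l (geod p v s))
  rw [ContinuousAt, lact_inv_lact] at hcont
  filter_upwards [hcont.eventually (hnear s)] with y hy hyH hpos
  rw [← hln, lorB_lact_left (H.group.le_SO hl)] at hpos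
  rw [← lact_inv l y]
  exact hinv l hl _ (hy (lact_mem_hypPlane (H.group.le_SO (G.inv_mem hl)) hyH) hpos)

include hsep

theorem SeparatesInto.isSide_right : IsSide (liftNormals G (lcross p v)) S₁ S₂ (-1) where
  closed := hsep.closed₁
  subset := hsep.union ▸ subset_union_left
  cover := hsep.union.ge
  inter x h1 h2 := (H.mem_fullLift.1 (hsep.inter ▸ ⟨h1, h2⟩)).2
  lift_mem n hn x hx h0 := (hsep.inter.ge (H.mem_fullLift.2 ⟨hx, n, hn, h0⟩)).1
  near n hn x hx h0 := H.near_of_near hsep.invariant₁ (fun s => by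
    have h1 := eventually_nhdsWithin_iff.1 (hsep.right s)
    filter_upwards [h1] with y hy hyH hpos
    refine hy ⟨hyH, ?_⟩
    rw [det3_geodVel]
    linarith) hn hx h0

theorem SeparatesInto.isSide_left : IsSide (liftNormals G (lcross p v)) S₂ S₁ 1 where
  closed := hsep.closed₂
  subset := hsep.union ▸ subset_union_right
  cover := hsep.union.ge.trans (union_comm _ _).le
  inter x h1 h2 := (H.mem_fullLift.1 (hsep.inter ▸ ⟨h2, h1⟩)).2
  lift_mem n hn x hx h0 := (hsep.inter.ge (H.mem_fullLift.2 ⟨hx, n, hn, h0⟩)).2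
  near n hn x hx h0 := H.near_of_near hsep.invariant₂ (fun s => by
    have h1 := eventually_nhdsWithin_iff.1 (hsep.left s)
    filter_upwards [h1] with y hy hyH hpos
    refine hy ⟨hyH, ?_⟩
    rw [det3_geodVel]
    linarith) hn hx h0

/-! ### Existence and uniqueness of the affine twist -/

/-- With zero push, `leftSide` is the indicator of the open left half-plane, which a path in the
right-hand piece neither enters nor leaves. -/
theorem SeparatesInto.crossSum_eq_zero {g : GL (Fin 3) ℝ} (hg : g ∈ pieceGroup G S₁ p) :
    crossSum (liftNormals G (lcross p v)) (p, 0) (lact g p, 0) = 0 := by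
  refine (finsum_mem_congr rfl fun n hn => ?_).trans (finsum_mem_zero _)
  have h1 := H.side_const (hsep.isSide_left H) (hsep.isSide_right H).subset hg.2 hn
  simp only [one_mul] at h1
  simp [leftSide, lorB_zero_right, h1]

omit hsep in
-- Pushing a point of the lift `k` to the left turns `leftSide` into the indicator of the closed
-- left half-plane for every lift, since no other lift passes through the point.
theorem IsSimpleAxis.leftSide_normal {k n : LVec} (hk : k ∈ liftNormals G (lcross p v)) {x : LVec}
    (hx : x ∈ hypPlane) (h0 : lorB k x = 0) (hn : n ∈ liftNormals G (lcross p v)) :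
    leftSide n (x, -k) = if 0 < -1 * lorB n x then 0 else 1 := by
  rcases lt_trichotomy (lorB n x) 0 with h1 | h1 | h1
  · rw [leftSide_of_neg h1, if_pos (by linarith)]
  · obtain rfl := H.eq_of_mem hn hk hx h1 h0
    obtain ⟨l, hl, rfl⟩ := hk
    rw [leftSide_of_zero_of_neg h1, if_neg (by rw [h1]; simp)]
    rw [lorB_neg_right, lorB_lact (H.group.le_SO hl), H.tangent.lorB_normal]
    norm_num
  · rw [leftSide_of_pos h1, if_neg (by linarith)]

omit hsep in
-- The push crosses only the lift through `p`.
theorem IsSimpleAxis.crossSum_push :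
    crossSum (liftNormals G (lcross p v)) (p, 0) (p, -lcross p v) = lcross p v := by
  classical
  have hN := self_mem_liftNormals G (lcross p v)
  have h0 := lorB_lcross_left p v
  have hp := H.tangent.base_mem
  unfold crossSum
  rw [finsum_eq_single _ (lcross p v)]
  · rw [finsum_eq_if, if_pos hN, H.leftSide_normal hN hp h0 hN,
      leftSide_of_zero_of_nonneg (P := (p, 0)) h0 (by simp [lorB_zero_right]), h0]
    simp
  · intro n hne
    rw [finsum_eq_if]
    split_ifs with hn
    · rw [H.leftSide_normal hN hp h0 hn]
      rcases lt_trichotomy (lorB n p) 0 with h1 | h1 | h1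
      · rw [leftSide_of_neg (P := (p, 0)) h1, if_pos (by linarith)]; simp
      · exact absurd (H.eq_of_mem hn hN hp h1 h0) hne
      · rw [leftSide_of_pos (P := (p, 0)) h1, if_neg (by linarith)]; simp
    · rfl

theorem SeparatesInto.crossSum_eq_sub {g : GL (Fin 3) ℝ} (hg : g ∈ pieceGroup G S₂ p) :
    crossSum (liftNormals G (lcross p v)) (p, 0) (lact g p, 0) =
      lcross p v - lact g (lcross p v) := by
  have hp := H.tangent.base_mem
  have hgp := lact_mem_hypPlane (H.group.le_SO hg.1) hp
  have hN := self_mem_liftNormals G (lcross p v)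
  have h0 := lorB_lcross_left p v
  -- Between the pushed endpoints nothing is crossed: a path in the left-hand piece never changes
  -- its status with respect to an open right half-plane.
  have hmid : crossSum (liftNormals G (lcross p v)) (p, -lcross p v)
      (lact g p, -lact g (lcross p v)) = 0 := by
    refine (finsum_mem_congr rfl fun n hn => ?_).trans (finsum_mem_zero _)
    have h1 := H.side_const (hsep.isSide_right H) (hsep.isSide_left H).subset hg.2 hn
    rw [H.leftSide_normal hN hp h0 hn, H.leftSide_normal (lact_mem_liftNormals hg.1 hN) hgp
      (by rw [lorB_lact (H.group.le_SO hg.1), h0]) hn]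
    simp only [h1, sub_self, zero_smul]
  have hlast := H.lact_crossSum hg.1 (P := (p, 0)) (Q := (p, -lcross p v)) hp hp
  rw [H.crossSum_push, lact_zero, lact_neg] at hlast
  have e1 := H.crossSum_add (P := (p, 0)) (Q := (p, -lcross p v))
    (R := (lact g p, -lact g (lcross p v))) hp hp hgp
  have e2 := H.crossSum_add (P := (p, 0)) (Q := (lact g p, 0))
    (R := (lact g p, -lact g (lcross p v))) hp hgp hgp
  rw [hmid, H.crossSum_push, add_zero] at e1
  rw [← hlast, ← e1] at e2
  exact eq_sub_of_add_eq e2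

theorem SeparatesInto.isAffineTwist : IsAffineTwist G (lcross p v) p S₁ S₂ fun g =>
    crossSum (liftNormals G (lcross p v)) (p, 0) (lact (g : GL (Fin 3) ℝ) p, 0) where
  cocycle := H.isLCocycle_crossSum
  first _ hg := hsep.crossSum_eq_zero H hg
  second _ hg := hsep.crossSum_eq_sub H hg

/-- The fundamental groups of the pieces generate: a cocycle that vanishes on both is zero. -/
theorem SeparatesInto.cocycle_eq_zero {d : G → LVec} (hd : IsLCocycle G d)
    (h₁ : ∀ g : G, (g : GL (Fin 3) ℝ) ∈ pieceGroup G S₁ p → d g = 0)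
    (h₂ : ∀ g : G, (g : GL (Fin 3) ℝ) ∈ pieceGroup G S₂ p → d g = 0) (g : G) : d g = 0 := by
  have hL := hsep.isSide_left H
  have hR := hsep.isSide_right H
  have hp := H.tangent.base_mem
  have hpiece : ∀ S, S = S₁ ∨ S = S₂ → ∃ S' ε, IsSide (liftNormals G (lcross p v)) S S' ε ∧
      IsSide (liftNormals G (lcross p v)) S' S (-ε) ∧ ε ≠ 0 := by
    rintro S (rfl | rfl)
    · exact ⟨S₂, -1, hR, by simpa using hL, by norm_num⟩
    · exact ⟨S₁, 1, hL, hR, by norm_num⟩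
  have hstep : ∀ S, S = S₁ ∨ S = S₂ → ∀ k k' : G, d k = 0 →
      JoinedIn S (lact (k : GL (Fin 3) ℝ) p) (lact (k' : GL (Fin 3) ℝ) p) → d k' = 0 := by
    intro S hS k k' hk hkk
    have hinv : ∀ g ∈ G, ∀ x ∈ S, lact g x ∈ S := by
      rcases hS with rfl | rfl
      · exact hsep.invariant₁
      · exact hsep.invariant₂
    have h3 := hkk.lact_image (hinv _ (G.inv_mem k.2))
    rw [lact_inv_lact, ← lact_mul] at h3
    have h4 : d (k⁻¹ * k') = 0 := by
      rcases hS with rfl | rfl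
      · exact h₁ _ ⟨(k⁻¹ * k').2, h3⟩
      · exact h₂ _ ⟨(k⁻¹ * k').2, h3⟩
    have h5 := hd k (k⁻¹ * k')
    rwa [mul_inv_cancel_left, h4, hk, lact_zero, add_zero] at h5
  -- The points that can be reached within one piece from a translate of `p` at which `d` vanishes.
  -- `P` is shown to be locally constant on the connected hyperbolic plane.
  let P : LVec → Prop := fun x => ∃ k : G, d k = 0 ∧ ∃ S, (S = S₁ ∨ S = S₂) ∧
    JoinedIn S (lact (k : GL (Fin 3) ℝ) p) x
  -- The piece can be changed only at a point of a lift. That lift lies in both pieces and contains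
  -- a translate of `p`, at which `d` vanishes by `hstep`; this translate serves as the new starting
  -- point.
  have hswitch : ∀ x, P x → ∀ S, S = S₁ ∨ S = S₂ → x ∈ S → ∃ k : G, d k = 0 ∧
      JoinedIn S (lact (k : GL (Fin 3) ℝ) p) x := by
    rintro x ⟨k, hk, T, hT, hj⟩ S hS hxS
    by_cases hTS : T = S
    · exact ⟨k, hk, hTS ▸ hj⟩
    have hx : x ∈ fullLift G p v := by
      rw [← hsep.inter]
      rcases hT with rfl | rfl <;> rcases hS with rfl | rfl
      · exact absurd rfl hTS
      · exact ⟨hj.target_mem, hxS⟩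
      · exact ⟨hxS, hj.target_mem⟩
      · exact absurd rfl hTS
    obtain ⟨l, hl, s, rfl⟩ := hx
    obtain ⟨_, _, hTs, -, -⟩ := hpiece T hT
    obtain ⟨_, _, hSs, -, -⟩ := hpiece S hS
    exact ⟨⟨l, hl⟩, hstep T hT k ⟨l, hl⟩ hk (hj.trans (H.joinedIn_lift hTs hl s).symm),
      H.joinedIn_lift hSs hl s⟩
  have hlocal : ∀ x ∈ hypPlane, ∀ᶠ y in 𝓝 x, y ∈ hypPlane → (P x ↔ P y) := by
    intro x hx
    have hj : ∀ S, S = S₁ ∨ S = S₂ → ∀ᶠ y in 𝓝 x, y ∈ S → JoinedIn S x y := by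
      intro S hS
      obtain ⟨S', ε, hs, hs', hε⟩ := hpiece S hS
      exact H.eventually_joinedIn hs hs' hε hx
    filter_upwards [hj S₁ (Or.inl rfl), hj S₂ (Or.inr rfl)] with y hy1 hy2 hyH
    have hy : ∀ S, S = S₁ ∨ S = S₂ → y ∈ S → JoinedIn S x y := by
      rintro S (rfl | rfl)
      · exact hy1
      · exact hy2
    constructor
    · intro hPx
      obtain ⟨S, hS, hyS⟩ : ∃ S, (S = S₁ ∨ S = S₂) ∧ y ∈ S := by
        rcases hR.cover hyH with h3 | h3
        · exact ⟨S₁, Or.inl rfl, h3⟩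
        · exact ⟨S₂, Or.inr rfl, h3⟩
      have hxy := hy S hS hyS
      obtain ⟨k, hk, hkx⟩ := hswitch x hPx S hS hxy.source_mem
      exact ⟨k, hk, S, hS, hkx.trans hxy⟩
    · rintro ⟨k, hk, S, hS, hky⟩
      exact ⟨k, hk, S, hS, hky.trans (hy S hS hky.target_mem).symm⟩
  have : PreconnectedSpace hypPlane := isPreconnected_iff_preconnectedSpace.1 isPreconnected_hypPlane
  have hclopen : IsClopen {x : hypPlane | P x} := by
    have hsub : ∀ x : hypPlane, ∀ᶠ y : hypPlane in 𝓝 x, (P x ↔ P y) := fun x => by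
      filter_upwards [continuous_subtype_val.continuousAt.eventually (hlocal x x.2)] with y hy
      exact hy y.2
    constructor
    · rw [← isOpen_compl_iff, isOpen_iff_mem_nhds]
      intro x hx
      filter_upwards [hsub x] with y hy hPy
      exact hx (hy.2 hPy)
    · rw [isOpen_iff_mem_nhds]
      intro x hx
      filter_upwards [hsub x] with y hy
      exact hy.1 hx
  have hone : d 1 = 0 := by
    have := hd 1 1
    simpa [lact_one] using this
  have hPp : P p := ⟨1, hone, S₁, Or.inl rfl, by
    have := H.joinedIn_lift hR G.one_mem 0
    simpa [geod_zero, lact_one] using this⟩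
  have huniv : {x : hypPlane | P x} = univ :=
    (isClopen_iff.1 hclopen).resolve_left (Set.nonempty_iff_ne_empty.1 ⟨⟨p, hp⟩, hPp⟩)
  have hgp : (⟨_, lact_mem_hypPlane (H.group.le_SO g.2) hp⟩ : hypPlane) ∈ {x : hypPlane | P x} :=
    huniv ▸ mem_univ _
  obtain ⟨k, hk, S, hS, hj⟩ := hgp
  exact hstep S hS k g hk hj

theorem SeparatesInto.affineTwist_unique {u u' : G → LVec} {X : LVec}
    (hu : IsAffineTwist G X p S₁ S₂ u) (hu' : IsAffineTwist G X p S₁ S₂ u') : u = u' := by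
  funext g
  refine sub_eq_zero.1 (hsep.cocycle_eq_zero H (d := fun g => u g - u' g) ?_ ?_ ?_ g)
  · intro g k
    simp only [hu.cocycle g k, hu'.cocycle g k, lact_sub]
    abel
  · intro g hg
    simp only [hu.first g hg, hu'.first g hg, sub_self]
  · intro g hg
    simp only [hu.second g hg, hu'.second g hg, sub_self]

end Separation

/-! ### Null vectors -/

theorem lorB_nonpos_of_null {x y : LVec} (hx : lorB x x = 0) (hy : lorB y y = 0) (hx2 : 0 < x 2)
    (hy2 : 0 < y 2) : lorB x y ≤ 0 := by
  simp only [lorB] at *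
  have key : (x 0 * y 0 + x 1 * y 1) ^ 2 ≤ (x 2 * y 2) ^ 2 := by
    have h1 : (x 2 * y 2) ^ 2 = (x 0 ^ 2 + x 1 ^ 2) * (y 0 ^ 2 + y 1 ^ 2) := by
      have h2 : x 2 ^ 2 = x 0 ^ 2 + x 1 ^ 2 := by linarith
      have h3 : y 2 ^ 2 = y 0 ^ 2 + y 1 ^ 2 := by linarith
      rw [mul_pow, h2, h3]
    rw [h1]
    nlinarith [sq_nonneg (x 0 * y 1 - x 1 * y 0)]
  have := (abs_le_of_sq_le_sq' key (mul_pos hx2 hy2).le).2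
  linarith

theorem smul_eq_smul_of_null {x y : LVec} (hx : lorB x x = 0) (hy : lorB y y = 0)
    (hxy : lorB x y = 0) : y 2 • x = x 2 • y := by
  simp only [lorB] at *
  have key : (y 2 * x 0 - x 2 * y 0) ^ 2 + (y 2 * x 1 - x 2 * y 1) ^ 2 = 0 := by
    linear_combination y 2 ^ 2 * hx + x 2 ^ 2 * hy - 2 * x 2 * y 2 * hxy
  ext i
  simp only [Pi.smul_apply, smul_eq_mul]
  fin_cases i
  · refine sub_eq_zero.1 (pow_eq_zero_iff two_ne_zero |>.1 (?_ : (y 2 * x 0 - x 2 * y 0) ^ 2 = 0))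
    linarith [sq_nonneg (y 2 * x 0 - x 2 * y 0), sq_nonneg (y 2 * x 1 - x 2 * y 1)]
  · refine sub_eq_zero.1 (pow_eq_zero_iff two_ne_zero |>.1 (?_ : (y 2 * x 1 - x 2 * y 1) ^ 2 = 0))
    linarith [sq_nonneg (y 2 * x 0 - x 2 * y 0), sq_nonneg (y 2 * x 1 - x 2 * y 1)]
  · exact mul_comm _ _

/-- The vectors `p + v` and `p - v` are null eigenvectors of `h`, so orthogonality of eigenspaces
forces `X0` to be plus or minus the normal. The future-pointing and orientation conditions select
the plus sign. -/
theorem IsNullFrame.eq_lcross {h : GL (Fin 3) ℝ} {X0 Xm Xp p v : LVec} (hX : IsNullFrame h X0 Xm Xp)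
    (hh : h ∈ lorSO) (hpv : IsAxis h p v) : X0 = lcross p v := by
  have hT := hpv.isUnitTangent
  have hL := transLen_nonneg hh
  set L := transLen h
  have hp1 : lact h (p + v) = Real.exp L • (p + v) := by
    rw [lact_add, hpv.translate_eq.1, hpv.translate_eq.2, geod, geodVel, ← Real.cosh_add_sinh]
    module
  have hm1 : lact h (p - v) = Real.exp (-L) • (p - v) := by
    rw [lact_sub, hpv.translate_eq.1, hpv.translate_eq.2, geod, geodVel, ← Real.cosh_sub_sinh]
    module
  -- Invariance gives `B(x,y) = a b B(x,y)` for eigenvectors with eigenvalues `a` and `b`.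
  have horth : ∀ {a b : ℝ} {x y : LVec}, lact h x = a • x → lact h y = b • y → a * b ≠ 1 →
      lorB x y = 0 := by
    intro a b x y hx hy hab
    have h1 := lorB_lact hh x y
    rw [hx, hy, lorB_smul_left, lorB_smul_right] at h1
    have h2 : (a * b - 1) * lorB x y = 0 := by linarith
    exact (mul_eq_zero.1 h2).resolve_left (sub_ne_zero.2 hab)
  obtain ⟨a, c, ha, hc, hXm, hXp⟩ := hX.eigen
  have hLpos : 0 < L := by
    refine lt_of_le_of_ne hL fun h0 => ?_
    rw [← h0, neg_zero, Real.exp_zero, one_smul] at hm1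
    rw [← h0, Real.exp_zero, one_smul] at hp1
    have hfix : ∀ x, lact h x = x := by
      intro x
      have h1 : lact h p = p := by rw [hpv.translate_eq.1]; change geod p v L = p; rw [← h0, geod_zero]
      have h2 : lact h v = v := by
        rw [hpv.translate_eq.2]; change geodVel p v L = v; rw [← h0, geodVel_zero]
      have h3 := hpv.lact_normal hh
      rw [hT.decomp x, lact_add, lact_add, lact_smul, lact_smul, lact_smul, h1, h2, h3]
    rw [hfix] at hXm
    have h4 := congrFun hXm 2
    simp only [Pi.smul_apply, smul_eq_mul] at h4
    nlinarith [hX.future_minus]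
  have he1 : 1 < Real.exp L := Real.one_lt_exp_iff.2 hLpos
  have he2 : Real.exp (-L) < 1 := Real.exp_lt_one_iff.2 (by linarith)
  have he : Real.exp L * Real.exp (-L) = 1 := by rw [← Real.exp_add, add_neg_cancel, Real.exp_zero]
  have hfix0 : lact h X0 = (1 : ℝ) • X0 := by rw [one_smul, hX.fixed]
  have hfixN : lact h (lcross p v) = (1 : ℝ) • lcross p v := by rw [one_smul, hpv.lact_normal hh]
  have e1 := horth hfix0 hp1 (by linarith)
  have e2 := horth hfix0 hm1 (by linarith)
  have e3 := horth hXm hfixN (by linarith)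
  have e4 := horth hXp hfixN (by linarith)
  have e5 := horth hXm hm1 (by
    intro h0
    have : a = Real.exp L := by
      calc a = a * (Real.exp L * Real.exp (-L)) := by rw [he, mul_one]
        _ = (a * Real.exp (-L)) * Real.exp L := by ring
        _ = Real.exp L := by rw [h0, one_mul]
    linarith)
  have e6 := horth hXp hp1 (by nlinarith)
  rw [lorB_add_right] at e1 e6
  rw [lorB_sub_right] at e2 e5
  have d0 := hT.decomp X0
  have dm := hT.decomp Xm
  have dp := hT.decomp Xp
  have f1 : lorB X0 p = 0 := by linarith
  have f2 : lorB X0 v = 0 := by linarith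
  rw [f1, f2] at d0
  rw [e3, show lorB Xm v = lorB Xm p by linarith] at dm
  rw [e4, show lorB Xp v = -lorB Xp p by linarith] at dp
  set b := lorB X0 (lcross p v)
  set α := lorB Xm p
  set β := lorB Xp p
  have d0' : X0 = b • lcross p v := by rw [d0]; module
  have dm' : Xm = (-α) • (p - v) := by rw [dm]; module
  have dp' : Xp = (-β) • (p + v) := by rw [dp]; module
  have hb2 : b ^ 2 = 1 := by
    have := hX.unit
    rw [d0', lorB_smul_left, lorB_smul_right, hT.lorB_normal] at this
    linarith
  have hαβ : 0 ≤ α * β := by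
    have := lorB_nonpos_of_null hX.null_minus hX.null_plus hX.future_minus hX.future_plus
    rw [dm', dp', lorB_smul_left, lorB_smul_right, lorB_add_right, lorB_sub_left, lorB_sub_left,
      hT.lorB_base, hT.tangent, hT.tangent', hT.unit] at this
    linarith
  have hdet : det3 X0 Xm Xp = 2 * b * (α * β) := by
    have h1 : det3 X0 Xm Xp = 2 * b * (α * β) * det3 (lcross p v) p v := by
      rw [d0', dm', dp']
      simp only [det3_eq, Pi.smul_apply, Pi.add_apply, Pi.sub_apply, smul_eq_mul]
      ring
    rw [h1, ← lorB_lcross, hT.lorB_normal, mul_one]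
  have hpos := hX.orient
  rw [hdet] at hpos
  have hbpos : 0 < b := by
    by_contra! hb
    have := mul_nonneg (neg_nonneg.2 hb) hαβ
    linarith
  have hb1 : b = 1 := by nlinarith
  rw [d0', hb1, one_smul]

/-! ### Translation length and trace -/

theorem IsUnitTangent.trace_eq {P V : LVec} (hT : IsUnitTangent P V) (g : GL (Fin 3) ℝ) :
    (g : Matrix (Fin 3) (Fin 3) ℝ).trace = -lorB (_root_.lact g P) P + lorB (_root_.lact g V) V +
      lorB (_root_.lact g (lcross P V)) (lcross P V) := by
  have key : ∀ i j : Fin 3, (Pi.single j 1 : LVec) i = ![1, 1, -1] j *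
      (-P j * P i + V j * V i + lcross P V j * lcross P V i) := by
    intro i j
    have := congrFun (hT.decomp (Pi.single j 1)) i
    rw [lorB_single, lorB_single, lorB_single] at this
    rw [this]
    simp only [Pi.add_apply, Pi.smul_apply, smul_eq_mul]
    ring
  generalize lcross P V = N at *
  have k00 := key 0 0
  have k01 := key 0 1
  have k02 := key 0 2
  have k11 := key 1 1
  have k12 := key 1 2
  have k22 := key 2 2
  simp at k00 k01 k02 k11 k12 k22
  set A : Matrix (Fin 3) (Fin 3) ℝ := (g : Matrix (Fin 3) (Fin 3) ℝ)
  have hl : ∀ x : LVec, ∀ i, _root_.lact g x i = A i 0 * x 0 + A i 1 * x 1 + A i 2 * x 2 := by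
    intro x i
    simp [_root_.lact, Matrix.mulVec, dotProduct, Fin.sum_univ_three, A]
  simp only [Matrix.trace_fin_three, lorB, hl]
  linear_combination A 0 0 * k00 + A 1 1 * k11 + A 2 2 * k22 + (A 0 1 + A 1 0) * k01
    + (A 2 0 - A 0 2) * k02 + (A 2 1 - A 1 2) * k12

theorem lact_normal_of_translate {g : GL (Fin 3) ℝ} (hg : g ∈ lorSO) {P V : LVec} {l : ℝ}
    (hP : lact g P = geod P V l) (hV : lact g V = geodVel P V l) :
    lact g (lcross P V) = lcross P V := by
  rw [lact_lcross hg, hP, hV, lcross_geod]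

theorem IsUnitTangent.trace_of_translate {g : GL (Fin 3) ℝ} (hg : g ∈ lorSO) {P V : LVec}
    (hT : IsUnitTangent P V) {l : ℝ} (hP : _root_.lact g P = _root_.geod P V l)
    (hV : _root_.lact g V = geodVel P V l) :
    (g : Matrix (Fin 3) (Fin 3) ℝ).trace = 1 + 2 * Real.cosh l := by
  rw [hT.trace_eq, lact_normal_of_translate hg hP hV, hP, hV, hT.lorB_normal]
  simp only [_root_.geod, geodVel, lorB_add_left, lorB_smul_left, hT.lorB_base, hT.tangent,
    hT.tangent', hT.unit]
  ring

theorem IsUnitTangent.transLen_of_translate {g : GL (Fin 3) ℝ} (hg : g ∈ lorSO) {P V : LVec}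
    (hT : IsUnitTangent P V) {l : ℝ} (hl : 0 ≤ l) (hP : _root_.lact g P = _root_.geod P V l)
    (hV : _root_.lact g V = geodVel P V l) : transLen g = l := by
  have hne : Nonempty hypPlane := ⟨⟨P, hT.base_mem⟩⟩
  have hPP : hypDist P (_root_.lact g P) = l := by
    rw [hypDist, hP, _root_.geod, lorB_add_right, lorB_smul_right, lorB_smul_right, hT.lorB_base,
      hT.tangent]
    rw [show -(Real.cosh l * -1 + Real.sinh l * 0) = Real.cosh l by ring, Real.arcosh_cosh hl]
  apply le_antisymm
  · have hbdd : BddBelow (range fun x : hypPlane => hypDist (x : LVec) (_root_.lact g x)) := by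
      refine ⟨0, ?_⟩
      rintro _ ⟨x, rfl⟩
      exact Real.arcosh_nonneg (one_le_neg_lorB x.2 (lact_mem_hypPlane hg x.2))
    exact (ciInf_le hbdd ⟨P, hT.base_mem⟩).trans hPP.le
  · refine le_ciInf fun x => ?_
    -- With `c` the normal coordinate of `x`, the `cosh` of the displacement is `(1 + c²) cosh l -
    -- c²`, which is least on the axis.
    have hle : Real.cosh l ≤ -lorB x (_root_.lact g x) := by
      have hx : lorB (x : LVec) x = -1 := x.2.1
      have hd := hT.decomp x
      have hN := lact_normal_of_translate hg hP hV
      have n1 : lorB (lcross P V) P = 0 := lorB_lcross_left P V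
      have n2 : lorB (lcross P V) V = 0 := lorB_lcross_right P V
      have n3 := hT.lorB_normal
      set a := lorB (x : LVec) P
      set b := lorB (x : LVec) V
      set c := lorB (x : LVec) (lcross P V)
      have hgx : _root_.lact g x = -a • _root_.geod P V l + b • geodVel P V l + c • lcross P V := by
        conv_lhs => rw [hd]
        rw [_root_.lact_add, _root_.lact_add, lact_smul, lact_smul, lact_smul, hP, hV, hN]
      have h1 : lorB (x : LVec) (_root_.lact g x) = -a ^ 2 * Real.cosh l + b ^ 2 * Real.cosh l + c ^ 2 := by
        rw [hgx]
        simp only [_root_.geod, geodVel, lorB_add_right, lorB_smul_right]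
        change -a * (Real.cosh l * a + Real.sinh l * b) + b * (Real.sinh l * a + Real.cosh l * b)
          + c * c = _
        ring
      have h2 : -a ^ 2 + b ^ 2 + c ^ 2 = -1 := by
        rw [← hx]
        conv_rhs => rw [hd, lorB_add_right, lorB_add_right, lorB_smul_right, lorB_smul_right,
          lorB_smul_right, ← hd]
        change _ = -a * a + b * b + c * c
        ring
      rw [h1]
      nlinarith [Real.one_le_cosh l, mul_nonneg (sq_nonneg c) (sub_nonneg.2 (Real.one_le_cosh l))]
    rw [hypDist, ← Real.arcosh_cosh hl]
    have hc := Real.cosh_pos l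
    exact (Real.arcosh_le_arcosh hc (by linarith)).2 hle

theorem lorSO_inv_apply_self {g : GL (Fin 3) ℝ} (hg : g ∈ lorSO) (i : Fin 3) :
    ((g⁻¹ : GL (Fin 3) ℝ) : Matrix (Fin 3) (Fin 3) ℝ) i i =
      (g : Matrix (Fin 3) (Fin 3) ℝ) i i := by
  have h := lorB_lact_left hg (Pi.single i 1) (Pi.single i 1)
  rw [lorB_comm, lorB_single, lorB_single, lact_single, lact_single] at h
  have h1 : (![1, 1, -1] : Fin 3 → ℝ) i ≠ 0 := by fin_cases i <;> simp
  exact (mul_left_cancel₀ h1 h).symm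

/-- The diagonal of the inverse, which is the adjugate, agrees with that of `g`. Hence the second
coefficient of the characteristic polynomial is again the trace, and the factor `1 - l` splits off.
-/
theorem det_sub_scalar {g : GL (Fin 3) ℝ} (hg : g ∈ lorSO) (l : ℝ) :
    ((g : Matrix (Fin 3) (Fin 3) ℝ) - l • (1 : Matrix (Fin 3) (Fin 3) ℝ)).det =
      (1 - l) * (l ^ 2 - ((g : Matrix (Fin 3) (Fin 3) ℝ).trace - 1) * l + 1) := by
  have h0 := lorSO_inv_apply_self hg 0
  have h1 := lorSO_inv_apply_self hg 1
  have h2 := lorSO_inv_apply_self hg 2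
  have hd := hg.2.1
  rw [Matrix.coe_units_inv, Matrix.inv_def, hd, Ring.inverse_one, one_smul,
    Matrix.adjugate_fin_three] at h0 h1 h2
  simp at h0 h1 h2
  rw [Matrix.det_fin_three] at hd
  simp [Matrix.det_fin_three, Matrix.trace_fin_three]
  linear_combination hd - l * (h0 + h1 + h2)

theorem exists_null_eigenvector {g : GL (Fin 3) ℝ} (hg : g ∈ lorSO) {l : ℝ} (hl1 : l ^ 2 ≠ 1)
    (hl : l ^ 2 - ((g : Matrix (Fin 3) (Fin 3) ℝ).trace - 1) * l + 1 = 0) :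
    ∃ e : LVec, lact g e = l • e ∧ lorB e e = 0 ∧ 0 < e 2 := by
  have hdet := det_sub_scalar hg l
  rw [hl, mul_zero] at hdet
  obtain ⟨e, hne, he⟩ := Matrix.exists_mulVec_eq_zero_iff.2 hdet
  rw [Matrix.sub_mulVec, Matrix.smul_mulVec, Matrix.one_mulVec, sub_eq_zero] at he
  have he' : lact g e = l • e := he
  have hnull : lorB e e = 0 := by
    have h1 := lorB_lact hg e e
    rw [he', lorB_smul_left, lorB_smul_right] at h1
    have h2 : (l ^ 2 - 1) * lorB e e = 0 := by linarith
    exact (mul_eq_zero.1 h2).resolve_left (sub_ne_zero.2 hl1)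
  have h2 : e 2 ≠ 0 := by
    intro h2
    apply hne
    simp only [lorB, h2] at hnull
    have h0 : e 0 = 0 := by nlinarith [sq_nonneg (e 0), sq_nonneg (e 1)]
    have h1 : e 1 = 0 := by nlinarith [sq_nonneg (e 0), sq_nonneg (e 1)]
    ext i
    fin_cases i <;> assumption
  rcases lt_or_gt_of_ne h2 with h3 | h3
  · refine ⟨-e, ?_, ?_, by simpa using h3⟩
    · rw [lact_neg, he', smul_neg]
    · rw [lorB_neg_left, lorB_neg_right, hnull]; simp
  · exact ⟨e, he', hnull, h3⟩

/-- For trace above 3 the other two eigenvalues are `exp l` and `exp (-l)`. Their null eigenvectors,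
suitably scaled, give `P + V` and `P - V` for a frame along the axis. -/
theorem transLen_eq_arcosh {g : GL (Fin 3) ℝ} (hg : g ∈ lorSO)
    (htr : 3 < (g : Matrix (Fin 3) (Fin 3) ℝ).trace) :
    transLen g = Real.arcosh (((g : Matrix (Fin 3) (Fin 3) ℝ).trace - 1) / 2) := by
  set c := ((g : Matrix (Fin 3) (Fin 3) ℝ).trace - 1) / 2 with hc
  have hc1 : 1 < c := by rw [hc]; linarith
  set l := Real.arcosh c
  have hl : 0 < l := Real.arcosh_pos hc1
  have hcosh : Real.cosh l = c := Real.cosh_arcosh hc1.le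
  have htr2 : (g : Matrix (Fin 3) (Fin 3) ℝ).trace - 1 = Real.exp l + Real.exp (-l) := by
    rw [Real.cosh_eq] at hcosh
    linarith
  have he : Real.exp l * Real.exp (-l) = 1 := by rw [← Real.exp_add, add_neg_cancel, Real.exp_zero]
  have he1 : 1 < Real.exp l := Real.one_lt_exp_iff.2 hl
  have he2 : Real.exp (-l) < 1 := Real.exp_lt_one_iff.2 (by linarith)
  have he0 := Real.exp_pos (-l)
  obtain ⟨e, hge, hee, he2'⟩ := exists_null_eigenvector hg (l := Real.exp l) (by nlinarith)
    (by rw [htr2]; linear_combination -he)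
  obtain ⟨f, hgf, hff, hf2⟩ := exists_null_eigenvector hg (l := Real.exp (-l)) (by nlinarith)
    (by rw [htr2]; linear_combination -he)
  have hef : lorB e f < 0 := by
    refine lt_of_le_of_ne (lorB_nonpos_of_null hee hff he2' hf2) fun h0 => ?_
    have h1 := smul_eq_smul_of_null hee hff h0
    have h2 := congrArg (lact g) h1
    rw [lact_smul, lact_smul, hge, hgf, smul_comm, smul_comm (e 2), h1] at h2
    have h3 := congrFun h2 2
    simp only [Pi.smul_apply, smul_eq_mul] at h3
    have h4 := mul_pos he2' hf2
    have h5 : (Real.exp l - Real.exp (-l)) * (e 2 * f 2) = 0 := by linarith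
    rcases mul_eq_zero.1 h5 with h6 | h6 <;> linarith
  -- This scale makes the sum of the two null vectors have Lorentz square `-1` and their difference
  -- `1`.
  set s := √((-2 * lorB e f)⁻¹)
  have hs : s ^ 2 * lorB e f = -1 / 2 := by
    rw [Real.sq_sqrt (inv_nonneg.2 (by linarith))]
    have : lorB e f ≠ 0 := hef.ne
    field_simp
  have hs0 : 0 < s := Real.sqrt_pos.2 (inv_pos.2 (by linarith))
  have hT : IsUnitTangent (s • (e + f)) (s • (e - f)) := by
    refine ⟨⟨?_, ?_⟩, ?_, ?_⟩
    · simp only [lorB_smul_left, lorB_smul_right, lorB_add_left, lorB_add_right, hee, hff,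
        lorB_comm f e]
      linear_combination 2 * hs
    · simp only [Pi.smul_apply, Pi.add_apply, smul_eq_mul]
      positivity
    · simp only [lorB_smul_left, lorB_smul_right, lorB_add_left, lorB_sub_right, hee, hff,
        lorB_comm f e]
      ring
    · simp only [lorB_smul_left, lorB_smul_right, lorB_sub_left, lorB_sub_right, hee, hff,
        lorB_comm f e]
      linear_combination -2 * hs
  refine hT.transLen_of_translate hg hl.le ?_ ?_
  · rw [lact_smul, lact_add, hge, hgf, geod, ← Real.cosh_add_sinh, ← Real.cosh_sub_sinh]
    module
  · rw [lact_smul, lact_sub, hge, hgf, geodVel, ← Real.cosh_add_sinh, ← Real.cosh_sub_sinh]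
    module

/-! ### The derivative of the translation length -/

theorem hasDerivAt_of_toSl2 {f : ℝ → LVec} {y : LVec} {t : ℝ}
    (hf : HasDerivAt (fun t => toSl2 (f t)) (toSl2 y) t) : HasDerivAt f y t := by
  have h1 : ∀ i j, HasDerivAt (fun t => toSl2 (f t) i j) (toSl2 y i j) t := fun i j =>
    hasDerivAt_pi.1 (hasDerivAt_pi.1 hf i) j
  have h00 : HasDerivAt (fun t => f t 0) (y 0) t := by simpa [toSl2] using h1 0 0
  have h01 : HasDerivAt (fun t => f t 1 - f t 2) (y 1 - y 2) t := by simpa [toSl2] using h1 0 1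
  have h10 : HasDerivAt (fun t => f t 1 + f t 2) (y 1 + y 2) t := by simpa [toSl2] using h1 1 0
  refine hasDerivAt_pi.2 fun i => ?_
  fin_cases i
  · exact h00
  · refine (((h01.add h10).div_const 2).congr_deriv (g' := y 1) (by ring)).congr_of_eventuallyEq
      (Eventually.of_forall fun s => ?_)
    change f s 1 = (f s 1 - f s 2 + (f s 1 + f s 2)) / 2
    ring
  · refine (((h10.sub h01).div_const 2).congr_deriv (g' := y 2) (by ring)).congr_of_eventuallyEq
      (Eventually.of_forall fun s => ?_)
    change f s 2 = (f s 1 + f s 2 - (f s 1 - f s 2)) / 2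
    ring

theorem HasDerivAt.lorB_const {f : ℝ → LVec} {y : LVec} {t : ℝ} (hf : HasDerivAt f y t)
    (z : LVec) : HasDerivAt (fun t => lorB (f t) z) (lorB y z) t := by
  have h := hasDerivAt_pi.1 hf
  exact (((h 0).mul_const _).add ((h 1).mul_const _)).sub ((h 2).mul_const _)

/-- The first variation of the translation length of `g` along an infinitesimal deformation
`u`. -/
theorem hasDerivAt_transLen {g : GL (Fin 3) ℝ} {q w : LVec} (hqw : IsAxis g q w)
    (hpos : 0 < transLen g) {ρ : ℝ → GL (Fin 3) ℝ} (hρ : ∀ t, ρ t ∈ lorSO) (h0 : ρ 0 = g) {u : LVec}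
    (hu : ∀ x, HasDerivAt (fun t => toSl2 (lact (ρ t) x)) ⁅toSl2 u, toSl2 (lact g x)⁆ 0) :
    HasDerivAt (fun t => transLen (ρ t)) (2 * lorB u (lcross q w)) 0 := by
  have hg : g ∈ lorSO := h0 ▸ hρ 0
  have hT := hqw.isUnitTangent
  obtain ⟨hgq, hgw⟩ := hqw.translate_eq
  have hgN := hqw.lact_normal hg
  set l := transLen g
  have hd : ∀ x, HasDerivAt (fun t => lact (ρ t) x) ((2 : ℝ) • lcross u (lact g x)) 0 := by
    intro x
    apply hasDerivAt_of_toSl2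
    rw [← toSl2_bracket]
    exact hu x
  have htr : HasDerivAt (fun t => (ρ t : Matrix (Fin 3) (Fin 3) ℝ).trace)
      (4 * Real.sinh l * lorB u (lcross q w)) 0 := by
    have h1 := (((hd q).lorB_const q).neg.add ((hd w).lorB_const w)).add
      ((hd (lcross q w)).lorB_const (lcross q w))
    refine (h1.congr_deriv ?_).congr_of_eventuallyEq
      (Eventually.of_forall fun t => hT.trace_eq (ρ t))
    rw [hgq, hgw, hgN, lorB_comm u]
    simp only [lorB_smul_left, lorB_lcross]
    generalize lcross q w = N
    simp only [det3_eq, geod, geodVel, Pi.add_apply, Pi.smul_apply, smul_eq_mul]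
    ring
  have htrace0 : (ρ 0 : Matrix (Fin 3) (Fin 3) ℝ).trace = 1 + 2 * Real.cosh l := by
    rw [h0, hT.trace_of_translate hg hgq hgw]
  have hcosh : 1 < Real.cosh l := Real.one_lt_cosh.2 hpos.ne'
  -- The trace formula for the length needs trace above 3, which persists near `0` by continuity.
  have hev : ∀ᶠ t in 𝓝 (0 : ℝ), 3 < (ρ t : Matrix (Fin 3) (Fin 3) ℝ).trace :=
    continuousAt_const.eventually_lt htr.continuousAt (by rw [htrace0]; linarith)
  have hc0 : ((ρ 0 : Matrix (Fin 3) (Fin 3) ℝ).trace - 1) / 2 = Real.cosh l := by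
    rw [htrace0]; ring
  have harc : HasDerivAt Real.arcosh (Real.sinh l)⁻¹
      (((ρ 0 : Matrix (Fin 3) (Fin 3) ℝ).trace - 1) / 2) := by
    rw [hc0]
    have h1 := Real.hasDerivAt_arcosh (x := Real.cosh l) hcosh
    have h2 : √(Real.cosh l ^ 2 - 1) = Real.sinh l := by
      rw [Real.cosh_sq, add_sub_cancel_right, Real.sqrt_sq (Real.sinh_pos_iff.2 hpos).le]
    rwa [h2] at h1
  have hcomp := harc.comp (0 : ℝ) ((htr.sub_const 1).div_const 2)
  have hsinh := (Real.sinh_pos_iff.2 hpos).ne'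
  refine (hcomp.congr_deriv ?_).congr_of_eventuallyEq ?_
  · field_simp
    ring
  · filter_upwards [hev] with t ht
    exact transLen_eq_arcosh (hρ t) ht

/-! ### Crossings of a geodesic with the lifts -/

theorem lorB_geod_of_zero {n q w : LVec} {s₀ : ℝ} (h0 : lorB n (geod q w s₀) = 0) (s : ℝ) :
    lorB n (geod q w s) = lorB n (geodVel q w s₀) * Real.sinh (s - s₀) ∧
      lorB n (geodVel q w s) = lorB n (geodVel q w s₀) * Real.cosh (s - s₀) := by
  obtain ⟨r, rfl⟩ : ∃ r, s = s₀ + r := ⟨s - s₀, by ring⟩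
  rw [geod_add, geodVel_add, geod.eq_def (geod q w s₀), geodVel.eq_def (geod q w s₀),
    add_sub_cancel_left]
  simp only [lorB_add_right, lorB_smul_right, h0]
  constructor <;> ring

theorem leftSide_geod_of_pos {n q w : LVec} {s₀ : ℝ} (h0 : lorB n (geod q w s₀) = 0)
    (hpos : 0 < lorB n (geodVel q w s₀)) (s : ℝ) :
    leftSide n (geod q w s, geodVel q w s) = if s₀ < s then 1 else 0 := by
  obtain ⟨h1, h2⟩ := lorB_geod_of_zero h0 s
  have hc := Real.cosh_pos (s - s₀)
  rcases lt_trichotomy s₀ s with h3 | rfl | h3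
  · have := Real.sinh_pos_iff.2 (sub_pos.2 h3)
    rw [if_pos h3, leftSide_of_pos]
    rw [h1]; positivity
  · rw [if_neg (lt_irrefl _), leftSide_of_zero_of_nonneg h0 hpos.le]
  · have := Real.sinh_neg_iff.2 (sub_neg.2 h3)
    rw [if_neg h3.not_gt, leftSide_of_neg]
    rw [h1]; exact mul_neg_of_pos_of_neg hpos this

theorem leftSide_geod_of_neg {n q w : LVec} {s₀ : ℝ} (h0 : lorB n (geod q w s₀) = 0)
    (hneg : lorB n (geodVel q w s₀) < 0) (s : ℝ) :
    leftSide n (geod q w s, geodVel q w s) = if s₀ < s then 0 else 1 := by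
  obtain ⟨h1, h2⟩ := lorB_geod_of_zero h0 s
  rcases lt_trichotomy s₀ s with h3 | rfl | h3
  · have := Real.sinh_pos_iff.2 (sub_pos.2 h3)
    rw [if_pos h3, leftSide_of_neg]
    rw [h1]; exact mul_neg_of_neg_of_pos hneg this
  · rw [if_neg (lt_irrefl _), leftSide_of_zero_of_neg h0 hneg]
  · have := Real.sinh_neg_iff.2 (sub_neg.2 h3)
    rw [if_neg h3.not_gt, leftSide_of_pos]
    rw [h1]; exact mul_pos_of_neg_of_neg hneg this

/-- A lift that contains the geodesic is never crossed, so it contributes nothing. -/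
theorem leftSide_geod_of_eq_zero {n q w : LVec} {s₀ : ℝ} (h0 : lorB n (geod q w s₀) = 0)
    (h0' : lorB n (geodVel q w s₀) = 0) (s : ℝ) :
    leftSide n (geod q w s, geodVel q w s) = 0 := by
  obtain ⟨h1, h2⟩ := lorB_geod_of_zero h0 s
  rw [h0', zero_mul] at h1 h2
  exact leftSide_of_zero_of_nonneg h1 h2.ge

/-- A lift that separates the ends of a segment of a geodesic crosses this segment. -/
theorem exists_zero_of_leftSide_ne {n q w : LVec} {l : ℝ} (hl : 0 < l)
    (hne : leftSide n (geod q w l, geodVel q w l) ≠ leftSide n (q, w)) :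
    ∃ s ∈ Ico 0 l, lorB n (geod q w s) = 0 ∧ lorB n (geodVel q w s) ≠ 0 := by
  have hcont : ContinuousOn (fun s => lorB n (geod q w s)) (Icc 0 l) :=
    ((continuous_lorB n).comp (continuous_geod q w)).continuousOn
  have hq : leftSide n (q, w) = leftSide n (geod q w 0, geodVel q w 0) := by
    rw [geod_zero, geodVel_zero]
  rw [hq] at hne
  obtain ⟨s, hs, h0⟩ : ∃ s ∈ Icc 0 l, lorB n (geod q w s) = 0 := by
    rcases le_total (lorB n (geod q w 0)) 0 with h1 | h1 <;>
      rcases le_total (lorB n (geod q w l)) 0 with h2 | h2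
    · rcases eq_or_lt_of_le h1 with h3 | h3
      · exact ⟨0, left_mem_Icc.2 hl.le, h3⟩
      · rcases eq_or_lt_of_le h2 with h4 | h4
        · exact ⟨l, right_mem_Icc.2 hl.le, h4⟩
        · exact absurd (by rw [leftSide_of_neg h4, leftSide_of_neg h3]) hne
    · exact intermediate_value_Icc hl.le hcont ⟨h1, h2⟩
    · exact intermediate_value_Icc' hl.le hcont ⟨h2, h1⟩
    · rcases eq_or_lt_of_le h1 with h3 | h3
      · exact ⟨0, left_mem_Icc.2 hl.le, h3.symm⟩
      · rcases eq_or_lt_of_le h2 with h4 | h4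
        · exact ⟨l, right_mem_Icc.2 hl.le, h4.symm⟩
        · exact absurd (by rw [leftSide_of_pos h4, leftSide_of_pos h3]) hne
  rcases lt_trichotomy (lorB n (geodVel q w s)) 0 with h1 | h1 | h1
  · refine ⟨s, ⟨hs.1, ?_⟩, h0, h1.ne⟩
    by_contra! h2
    apply hne
    rw [leftSide_geod_of_neg h0 h1, leftSide_geod_of_neg h0 h1, if_neg h2.not_gt,
      if_neg hs.1.not_gt]
  · exact absurd (by rw [leftSide_geod_of_eq_zero h0 h1, leftSide_geod_of_eq_zero h0 h1]) hne
  · refine ⟨s, ⟨hs.1, ?_⟩, h0, h1.ne'⟩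
    by_contra! h2
    apply hne
    rw [leftSide_geod_of_pos h0 h1, leftSide_geod_of_pos h0 h1, if_neg h2.not_gt,
      if_neg hs.1.not_gt]

theorem IsUnitTangent.abs_lorB_le_one {x a b : LVec} (ha : IsUnitTangent x a)
    (hb : IsUnitTangent x b) : |lorB a b| ≤ 1 := by
  have hd := ha.decomp b
  have h1 := hb.unit
  have h2 : lorB b b = lorB b a * lorB b a +
      lorB b (lcross x a) * lorB b (lcross x a) := by
    conv_lhs =>
      rw [hd, lorB_add_right, lorB_add_right, lorB_smul_right, lorB_smul_right, lorB_smul_right,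
        ← hd, hb.tangent']
    ring
  rw [lorB_comm a b]
  apply abs_le_one_iff_mul_self_le_one.2
  nlinarith [mul_self_nonneg (lorB b (lcross x a))]

theorem cos_leftAngle {x a b : LVec} (ha : IsUnitTangent x a) (hb : IsUnitTangent x b) :
    Real.cos (leftAngle x a b) = (if 0 < det3 a b x then 1 else -1) * lorB a b := by
  have h1 := abs_le.1 (ha.abs_lorB_le_one hb)
  unfold leftAngle
  split_ifs
  · rw [Real.cos_arccos h1.1 h1.2, one_mul]
  · rw [Real.cos_arccos (by linarith) (by linarith), neg_one_mul]

namespace IsSimpleAxis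

variable {G : Subgroup (GL (Fin 3) ℝ)} {h σ : GL (Fin 3) ℝ} {p v q w : LVec}
  (H : IsSimpleAxis G h p v)
include H

/-- Data of a crossing in terms of the lift that the second geodesic crosses. -/
theorem crossing_lift {c : ℝ × ℝ × GL (Fin 3) ℝ} (hc : c ∈ crossings G h σ p v q w) :
    lorB (lact c.2.2 (lcross p v)) (geod q w c.1) = 0 ∧
      det3 (lact c.2.2 (geodVel p v c.2.1)) (geodVel q w c.1) (geod q w c.1) =
        lorB (lact c.2.2 (lcross p v)) (geodVel q w c.1) := by
  obtain ⟨-, -, hk, heq, -⟩ := hc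
  rw [← heq]
  refine ⟨H.lorB_lact_normal_geod hk _, ?_⟩
  rw [lact_geod, lact_geodVel, det3_geodVel, lact_lcross (H.group.le_SO hk)]

theorem bijOn_crossings (hT : IsUnitTangent q w) : BijOn (fun c : ℝ × ℝ × GL (Fin 3) ℝ => lact c.2.2 (lcross p v))
    (crossings G h σ p v q w)
    {n ∈ liftNormals G (lcross p v) | ∃ s ∈ Ico 0 (transLen σ), lorB n (geod q w s) = 0 ∧
      lorB n (geodVel q w s) ≠ 0} := by
  refine ⟨fun c hc => ?_, fun c hc c' hc' hcc => ?_, ?_⟩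
  · obtain ⟨h0, hdet⟩ := H.crossing_lift hc
    exact ⟨⟨_, hc.2.2.1, rfl⟩, c.1, hc.1, h0, hdet ▸ hc.2.2.2.2⟩
  · obtain ⟨h0, hdet⟩ := H.crossing_lift hc
    obtain ⟨h0', -⟩ := H.crossing_lift hc'
    have hne := hc.2.2.2.2
    rw [hdet] at hne
    change lact c.2.2 (lcross p v) = lact c'.2.2 (lcross p v) at hcc
    rw [← hcc, (lorB_geod_of_zero h0 c'.1).1] at h0'
    -- A geodesic meets a lift transversally at most once, because `sinh` has a single zero.
    have hs : c.1 = c'.1 := by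
      have := Real.sinh_eq_zero.1 ((mul_eq_zero.1 h0').resolve_left hne)
      linarith
    have heq : lact c.2.2 (geod p v c.2.1) = lact c'.2.2 (geod p v c'.2.1) := by
      rw [hc.2.2.2.1, hc'.2.2.2.1, hs]
    obtain ⟨m, hk, ht⟩ := H.exists_zpow_of_lact_eq hc.2.2.1 hc'.2.2.1 heq
    have hL := H.transLen_pos
    have hm : m = 0 := by
      have h1 := hc.2.1
      have h2 := hc'.2.1
      have h3 : (m : ℝ) * transLen h < 1 * transLen h := by linarith [h1.1, h2.2]
      have h4 : (-1 : ℝ) * transLen h < m * transLen h := by linarith [h1.2, h2.1]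
      have h5 := lt_of_mul_lt_mul_right h3 hL.le
      have h6 := lt_of_mul_lt_mul_right h4 hL.le
      norm_cast at h5 h6
      omega
    rw [hm, zpow_zero, mul_one] at hk
    rw [hm, Int.cast_zero, zero_mul, add_zero] at ht
    exact Prod.ext hs (Prod.ext ht.symm hk)
  · rintro _ ⟨⟨k, hk, rfl⟩, s, hs, h0, hne⟩
    obtain ⟨l, hl, t, ht, hst, hlk⟩ := H.exists_lact_geod_Ico hk (hT.geod s).base_mem h0
    refine ⟨(s, t, l), ⟨hs, ht, hl, hst.symm, ?_⟩, hlk⟩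
    change det3 (lact l (geodVel p v t)) (geodVel q w s) (geod q w s) ≠ 0
    rwa [hst, lact_geod, lact_geodVel, det3_geodVel, ← lact_lcross (H.group.le_SO hl), hlk]

theorem cos_crossAngle (hT : IsUnitTangent q w) (hqw : IsAxis σ q w)
    {c : ℝ × ℝ × GL (Fin 3) ℝ} (hc : c ∈ crossings G h σ p v q w) :
    (leftSide (lact c.2.2 (lcross p v)) (lact σ q, lact σ w) -
      leftSide (lact c.2.2 (lcross p v)) (q, w)) *
        lorB (lact c.2.2 (lcross p v)) (lcross q w) = Real.cos (crossAngle p v q w c) := by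
  obtain ⟨h0, hdet⟩ := H.crossing_lift hc
  obtain ⟨hs, -, hk, heq, hne⟩ := hc
  have hkS := H.group.le_SO hk
  have ha : IsUnitTangent (geod q w c.1) (lact c.2.2 (geodVel p v c.2.1)) :=
    heq ▸ (H.tangent.geod c.2.1).lact hkS
  have hb := hT.geod c.1
  -- Both normals are cross products with the same point of the hyperboloid, so their product equals
  -- that of the tangents.
  have hB : lorB (lact c.2.2 (lcross p v)) (lcross q w) =
      lorB (lact c.2.2 (geodVel p v c.2.1)) (geodVel q w c.1) := by
    rw [← lcross_geod p v c.2.1, ← lcross_geod q w c.1, lact_lcross hkS, heq, lorB_lcross_lcross,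
      hb.tangent, hb.lorB_base]
    ring
  rw [crossAngle, cos_leftAngle ha hb, hB, hdet]
  rw [hdet] at hne
  congr 1
  have hq : (q, w) = (geod q w 0, geodVel q w 0) := by rw [geod_zero, geodVel_zero]
  rw [hqw.translate_eq.1, hqw.translate_eq.2, hq]
  rcases lt_or_gt_of_ne hne with h1 | h1
  · rw [leftSide_geod_of_neg h0 h1, leftSide_geod_of_neg h0 h1, if_pos hs.2, if_neg hs.1.not_gt,
      if_neg h1.not_gt]
    norm_num
  · rw [leftSide_geod_of_pos h0 h1, leftSide_geod_of_pos h0 h1, if_pos hs.2, if_neg hs.1.not_gt,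
      if_pos h1]
    norm_num

theorem finite_crossings (hqw : IsAxis σ q w) : (crossings G h σ p v q w).Finite := by
  have hT := hqw.isUnitTangent
  rw [(H.bijOn_crossings hT).finite_iff_finite]
  refine (H.finite_separating (P := (q, w)) (Q := (geod q w (transLen σ),
    geodVel q w (transLen σ))) hT.base_mem (hT.geod _).base_mem).subset ?_
  rintro n ⟨hn, s, hs, h0, hne⟩
  refine ⟨hn, ?_⟩
  have hq : (q, w) = (geod q w 0, geodVel q w 0) := by rw [geod_zero, geodVel_zero]
  rw [hq]
  rcases lt_or_gt_of_ne hne with h1 | h1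
  · rw [leftSide_geod_of_neg h0 h1, leftSide_geod_of_neg h0 h1, if_pos hs.2, if_neg hs.1.not_gt]
    norm_num
  · rw [leftSide_geod_of_pos h0 h1, leftSide_geod_of_pos h0 h1, if_pos hs.2, if_neg hs.1.not_gt]
    norm_num

/-- The crossing cocycle, paired with the normal of an axis, is the sum of the cosines of the
angles at the crossings. -/
theorem lorB_crossSum_eq_sum_cos (hσ : σ ∈ G) (hσ1 : σ ≠ 1) (hqw : IsAxis σ q w) :
    lorB (crossSum (liftNormals G (lcross p v)) (p, 0) (lact σ p, 0)) (lcross q w) =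
      ∑ᶠ c ∈ crossings G h σ p v q w, Real.cos (crossAngle p v q w c) := by
  have hT := hqw.isUnitTangent
  have hσS := H.group.le_SO hσ
  have hp := H.tangent.base_mem
  have hq := hT.base_mem
  have hσp := lact_mem_hypPlane hσS hp
  have hσq := lact_mem_hypPlane hσS hq
  -- The new base point carries the push `-w`, backwards along the geodesic: a crossing at `q` is
  -- counted and one at `σ q` is not, matching the half-open period.
  have e1 := H.crossSum_add (P := (p, 0)) (Q := (q, w)) (R := (lact σ q, lact σ w)) hp hq hσq
  have e2 := H.crossSum_add (P := (p, 0)) (Q := (lact σ p, 0)) (R := (lact σ q, lact σ w))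
    hp hσp hσq
  have e3 := H.lact_crossSum hσ (P := (p, 0)) (Q := (q, w)) hp hq
  rw [lact_zero] at e3
  rw [← e3, ← e1] at e2
  have e4 := congrArg (fun x => lorB x (lcross q w)) e2
  simp only [lorB_add_left] at e4
  have e5 : lorB (lact σ (crossSum (liftNormals G (lcross p v)) (p, 0) (q, w))) (lcross q w) =
      lorB (crossSum (liftNormals G (lcross p v)) (p, 0) (q, w)) (lcross q w) := by
    conv_lhs => rw [← hqw.lact_normal hσS, lorB_lact hσS]
  have e6 : lorB (crossSum (liftNormals G (lcross p v)) (p, 0) (lact σ p, 0)) (lcross q w) =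
      lorB (crossSum (liftNormals G (lcross p v)) (q, w) (lact σ q, lact σ w)) (lcross q w) := by
    linarith
  rw [e6, H.lorB_crossSum hq hσq]
  rw [finsum_mem_eq_of_bijOn _ (H.bijOn_crossings hT)
    (g := fun n => (leftSide n (lact σ q, lact σ w) - leftSide n (q, w)) * lorB n (lcross q w))
    fun c hc => (H.cos_crossAngle hT hqw hc).symm]
  -- A lift with a nonzero term separates the ends of the period, hence crosses it.
  apply finsum_mem_inter_support_eq
  ext n
  refine ⟨fun ⟨hn, hsupp⟩ => ⟨⟨hn, ?_⟩, hsupp⟩, fun ⟨hn, hsupp⟩ => ⟨hn.1, hsupp⟩⟩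
  refine exists_zero_of_leftSide_ne (hqw.transLen_pos H.group hσ hσ1) fun heq => hsupp ?_
  change (leftSide n (lact σ q, lact σ w) - leftSide n (q, w)) * lorB n (lcross q w) = 0
  rw [hqw.translate_eq.1, hqw.translate_eq.2, heq, sub_self, zero_mul]

end IsSimpleAxis

end

/-! ### The affine twist and the derivative formula -/

theorem theorem2
    (G : Subgroup (GL (Fin 3) ℝ)) (hG : IsSurfaceGroup G)
    (h : G) (X0 Xm Xp : LVec) (hX : IsNullFrame (h : GL (Fin 3) ℝ) X0 Xm Xp)
    (p v : LVec) (hpv : IsAxis (h : GL (Fin 3) ℝ) p v)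
    (hsimple : IsSimpleLoop G (h : GL (Fin 3) ℝ) p v)
    (S₁ S₂ : Set LVec) (hsep : SeparatesInto G p v S₁ S₂) :
    (∃! u : G → LVec, IsAffineTwist G X0 p S₁ S₂ u) ∧
    ∀ u : G → LVec, IsAffineTwist G X0 p S₁ S₂ u →
    ∀ ρ : ℝ → G →* GL (Fin 3) ℝ, IsDeformationAlong G u ρ →
    ∀ σ : G, σ ≠ 1 → ∀ q w : LVec, IsAxis (σ : GL (Fin 3) ℝ) q w →
      (crossings G (h : GL (Fin 3) ℝ) (σ : GL (Fin 3) ℝ) p v q w).Finite ∧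
      HasDerivAt (fun t => transLen (ρ t σ))
        (2 * ∑ᶠ c ∈ crossings G (h : GL (Fin 3) ℝ) (σ : GL (Fin 3) ℝ) p v q w,
          Real.cos (crossAngle p v q w c)) 0 := by
  have h_ne : (h : GL (Fin 3) ℝ) ≠ 1 := by
    intro h1
    obtain ⟨a, -, ha, -, hXm, -⟩ := hX.eigen
    rw [h1, lact_one] at hXm
    have h2 := congrFun hXm 2
    simp only [Pi.smul_apply, smul_eq_mul] at h2
    nlinarith [hX.future_minus]
  have H : IsSimpleAxis G (h : GL (Fin 3) ℝ) p v := ⟨hG, h.2, h_ne, hpv, hsimple⟩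
  obtain rfl := hX.eq_lcross H.mem_SO hpv
  have htwist := hsep.isAffineTwist H
  refine ⟨⟨_, htwist, fun u hu => hsep.affineTwist_unique H hu htwist⟩, ?_⟩
  intro u hu ρ hρ σ hσ q w hqw
  have hσ1 : (σ : GL (Fin 3) ℝ) ≠ 1 := fun h1 => hσ (Subtype.ext h1)
  refine ⟨H.finite_crossings hqw, ?_⟩
  obtain ⟨z, hz⟩ := hρ.tangent
  have hder := hasDerivAt_transLen hqw (hqw.transLen_pos hG σ.2 hσ1) (ρ := fun t => ρ t σ)
    (fun t => hρ.mem_SO t σ) (hρ.initial σ) (hz σ)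
  have hcob : lorB (lact (σ : GL (Fin 3) ℝ) z) (lcross q w) = lorB z (lcross q w) := by
    conv_lhs => rw [← hqw.lact_normal (hG.le_SO σ.2), lorB_lact (hG.le_SO σ.2)]
  rw [lorB_add_left, lorB_sub_left, hcob, sub_self, add_zero,
    hsep.affineTwist_unique H hu htwist, H.lorB_crossSum_eq_sum_cos σ.2 hσ1 hqw] at hder
  exact hder
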